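/- For $\kappa\in\mathbb{R}$, let $M_\kappa^2$ be the complete, simply connected, two-dimensional Riemannian manifold of constant Gaussian curvature $\kappa$, let $d_\kappa$ be its distance function, and let $D_\kappa$ be its diameter, that is, $D_\kappa=\pi/\sqrt{\kappa}$ if $\kappa>0$ and $D_\kappa=\infty$ if $\kappa\le 0$. For an integer $n\ge 4$, a metric space $(X,d_X)$ is called a $\mathrm{Cycl}_n(\kappa)$ space if for every map $f:\mathbb{Z}/n\mathbb{Z}\to X$ with $$\sum_{i\in\mathbb{Z}/n\mathbb{Z}} d_X(f(i),f(i+1))<2D_\kappa$$ there exists a map $g:\mathbb{Z}/n\mathbb{Z}\to M_\kappa^2$ such that $$d_\kappa(g(i),g(i+1))\le d_X(f(i),f(i+1)),\qquad d_\kappa(g(i),g(j))\ge d_X(f(i),f(j))$$ for all $i,j\in\mathbb{Z}/n\mathbb{Z}$ with $j\ne i+1$ and $i\ne j+1$. **Theorem.** Let $\kappa\in\mathbb{R}$. If a metric space is a $\mathrm{Cycl}_4(\kappa)$ space, then it is a $\mathrm{Cycl}_n(\kappa)$ space for every integer $n\ge 4$. -/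

import Mathlib

open scoped BigOperators

/-- A set together with a distance function. -/
structure DistPlane where
  carrier : Type
  d : carrier → carrier → ℝ

/-- The model plane of constant curvature `κ` with its Riemannian distance function `d_κ`:
* for `κ > 0`, the unit sphere of Euclidean 3-space with the angular distance
  multiplied by `1 / √κ`;
* for `κ < 0`, the hyperbolic plane (Mathlib's upper half plane, of curvature `-1`) with its
  distance multiplied by `1 / √(-κ)`;
* for `κ = 0`, the Euclidean plane. -/
noncomputable def modelPlane (κ : ℝ) : DistPlane :=
  open Classical in
  if 0 < κ then
    { carrier := Metric.sphere (0 : EuclideanSpace ℝ (Fin 3)) 1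
      d := fun x y => InnerProductGeometry.angle
        (x : EuclideanSpace ℝ (Fin 3)) (y : EuclideanSpace ℝ (Fin 3)) / Real.sqrt κ }
  else if κ < 0 then
    { carrier := UpperHalfPlane
      d := fun x y => dist x y / Real.sqrt (-κ) }
  else
    { carrier := EuclideanSpace ℝ (Fin 2)
      d := fun x y => dist x y }

/-- The diameter `D_κ` of the model plane: `π / √κ` for `κ > 0`, and `∞` for `κ ≤ 0`. -/
noncomputable def modelDiam (κ : ℝ) : ENNReal :=
  open Classical in
  if 0 < κ then ENNReal.ofReal (Real.pi / Real.sqrt κ) else ⊤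

/-- The `Cycl_n(κ)` condition for a metric space `X`: every closed `n`-gon `f` in `X` of
perimeter less than `2 D_κ` has a comparison polygon `g` in the model plane whose sides are not
longer and whose diagonals are not shorter than those of `f`. -/
def IsCycl (κ : ℝ) (n : ℕ) [NeZero n] (X : Type*) [MetricSpace X] : Prop :=
  ∀ f : ZMod n → X,
    ENNReal.ofReal (∑ i : ZMod n, dist (f i) (f (i + 1))) < 2 * modelDiam κ →
    ∃ g : ZMod n → (modelPlane κ).carrier,
      (∀ i : ZMod n, (modelPlane κ).d (g i) (g (i + 1)) ≤ dist (f i) (f (i + 1))) ∧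
      (∀ i j : ZMod n, j ≠ i + 1 → i ≠ j + 1 →
        dist (f i) (f j) ≤ (modelPlane κ).d (g i) (g j))

/-!
The proof follows Reshetnyak's gluing argument, carried out for functions on the vertices of a
polygon instead of curves in a geodesic space.

All model planes are treated at once. Up to scaling, the model plane is the quadric
`k (x² + y²) + z² = 1` in `ℝ³` with `k ∈ {1, 0, -1}` (`Pt k`), segments are cut out by cones
(`InSeg`), and distances are measured by squared chords, which satisfy a uniform law of cosines
(`phi_polar`) and a uniform Stewart theorem (`stewart`).

The `Cycl₄(κ)` condition enters only as the hypothesis `quad` of `IsPolyDist`: a function `D` of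
pairs of vertices `0, …, N`, with the triangle inequality and small perimeter, such that any four
vertices have a comparison quadrilateral with sides at most, and diagonals at least, the values of
`D`. The claim, `exists_realizes`, is that such a `D` is realized by a convex polygon with sides
exactly `D` and diagonals at least `D`. It is proved by induction on the number of vertices.

Let `g` be a convex realization of `0, …, N`, and glue to its closing edge `[g 0, g N]` a triangle
with apex `w`, which stands for the vertex `N + 1`. Measure the distance from `w` to `g i` by the
shortest path through the edge; this gives a new function `F` (`exists_fold`). It dominates `D` by
`cross_le`: in a quadrilateral, shorter sides and a longer diagonal force a shorter second diagonal.
It also satisfies the quadrilateral condition, because for every vertex `g i` the point `w` can be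
moved, without getting farther from any point of the edge, to a point whose straight distance from
`g i` equals the length of that shortest path (`exists_straighten`).

If the glued polygon is convex, it is the desired realization (`realize_of_cross`). Otherwise it is
reflex at an end of the gluing edge, by the alternative in `exists_apex` and the monotonicity
`Refl.mono`. At a reflex vertex `v` the shortest path between the neighbours of `v` passes through
`v`. The induction hypothesis applied to `F` on the other vertices gives a polygon with a side of
exactly that length; subdividing this side puts `v` back, and the distances from `v` are large
enough since cevians are monotone in the sides (`cevian_mono`). The crossing of diagonals, which
encodes convexity, is inherited by Pasch's axiom (`pasch`).
-/

namespace ModelGeometry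

/-! ### Trigonometry in constant curvature -/

/-- The generalized sine: `sin`, the identity or `sinh`, according to the sign of the
curvature. -/
noncomputable def sn : SignType → ℝ → ℝ
  | .pos => Real.sin
  | .zero => id
  | .neg => Real.sinh

/-- The generalized cosine: `cos`, the constant `1` or `cosh`, according to the sign of the
curvature. -/
noncomputable def cs : SignType → ℝ → ℝ
  | .pos => Real.cos
  | .zero => fun _ => 1
  | .neg => Real.cosh

/-- The inverse function of `sn`. -/
noncomputable def asn : SignType → ℝ → ℝ
  | .pos => Real.arcsin
  | .zero => id
  | .neg => Real.arsinh

/-- The squared chord `4 sn(t/2)²` of an arc of length `t`. It is a common replacement for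
`2 - 2 cos t`, `t²` and `2 cosh t - 2`. -/
noncomputable def chord (k : SignType) (t : ℝ) : ℝ := 4 * sn k (t / 2) ^ 2

/-- `LtDiam k t` says that `t` is smaller than the diameter of the model plane of curvature `k`. -/
def LtDiam (k : SignType) (t : ℝ) : Prop := k = .pos → t < Real.pi

/-- `LeDiam k t` says that `t` is at most the diameter of the model plane of curvature `k`. -/
def LeDiam (k : SignType) (t : ℝ) : Prop := k = .pos → t ≤ Real.pi

variable {k : SignType}

lemma LtDiam.le {t : ℝ} (h : LtDiam k t) : LeDiam k t := fun hk => (h hk).le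

lemma LtDiam.mono {s t : ℝ} (h : LtDiam k t) (hst : s ≤ t) : LtDiam k s :=
  fun hk => hst.trans_lt (h hk)

lemma sign_cube (k : SignType) : (k : ℝ) ^ 3 = k := by
  cases k <;> norm_num

lemma cs_sq (k : SignType) (t : ℝ) : cs k t ^ 2 + k * sn k t ^ 2 = 1 := by
  cases k
  · simp [cs]
  · have := Real.cosh_sq_sub_sinh_sq t
    simp only [cs, sn, SignType.neg_eq_neg_one, SignType.coe_neg_one]
    linarith
  · simp [cs, sn]

lemma sn_add (k : SignType) (s t : ℝ) :
    sn k (s + t) = sn k s * cs k t + cs k s * sn k t := by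
  cases k
  · simp [cs, sn]
  · simpa [cs, sn] using Real.sinh_add s t
  · simpa [cs, sn] using Real.sin_add s t

lemma sn_sub (k : SignType) (s t : ℝ) :
    sn k (s - t) = sn k s * cs k t - cs k s * sn k t := by
  cases k
  · simp [cs, sn]
  · simpa [cs, sn] using Real.sinh_sub s t
  · simpa [cs, sn] using Real.sin_sub s t

@[simp] lemma sn_zero (k : SignType) : sn k 0 = 0 := by
  cases k <;> simp [sn]

@[simp] lemma cs_zero (k : SignType) : cs k 0 = 1 := by
  cases k <;> simp [cs]

@[simp] lemma sn_neg (k : SignType) (t : ℝ) : sn k (-t) = - sn k t := by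
  cases k <;> simp [sn]

@[simp] lemma cs_neg (k : SignType) (t : ℝ) : cs k (-t) = cs k t := by
  cases k <;> simp [cs]

lemma chord_pos_sign (t : ℝ) : chord .pos t = 2 - 2 * Real.cos t := by
  have h := Real.cos_sq (t / 2)
  have h2 := Real.sin_sq_add_cos_sq (t / 2)
  have h3 : 2 * (t / 2) = t := by ring
  rw [h3] at h
  simp only [chord, sn]
  linarith

lemma chord_zero_sign (t : ℝ) : chord .zero t = t ^ 2 := by
  simp only [chord, sn, id]; ring

lemma chord_neg_sign (t : ℝ) : chord .neg t = 2 * Real.cosh t - 2 := by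
  have h := Real.cosh_two_mul (t / 2)
  have h2 := Real.cosh_sq_sub_sinh_sq (t / 2)
  have h3 : 2 * (t / 2) = t := by ring
  rw [h3] at h
  simp only [chord, sn]
  linarith

@[simp] lemma chord_zero (k : SignType) : chord k 0 = 0 := by simp [chord]

@[simp] lemma chord_neg (k : SignType) (t : ℝ) : chord k (-t) = chord k t := by
  simp [chord, neg_div]

lemma cs_eq (k : SignType) (t : ℝ) : cs k t = 1 - k / 2 * chord k t := by
  cases k
  · simp [cs]
  · simp only [cs, SignType.neg_eq_neg_one, SignType.coe_neg_one]
    rw [← SignType.neg_eq_neg_one, chord_neg_sign]; ring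
  · simp only [cs, SignType.pos_eq_one, SignType.coe_one]
    rw [← SignType.pos_eq_one, chord_pos_sign]; ring

lemma chord_add (k : SignType) (s t : ℝ) :
    chord k (s + t) = chord k s + cs k s * chord k t + 2 * sn k s * sn k t := by
  cases k
  · simp only [chord, cs, sn, id]; ring
  · simp only [chord_neg_sign, cs, sn, Real.cosh_add]; ring
  · simp only [chord_pos_sign, cs, sn, Real.cos_add]; ring

lemma chord_sub (k : SignType) (s t : ℝ) :
    chord k (s - t) = chord k s + cs k s * chord k t - 2 * sn k s * sn k t := by
  rw [sub_eq_add_neg, chord_add]; simp; ring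

lemma chord_symm (k : SignType) (s t : ℝ) :
    chord k s + cs k s * chord k t = chord k t + cs k t * chord k s := by
  simp only [cs_eq]; ring

lemma sn_sq (k : SignType) (t : ℝ) : sn k t ^ 2 = chord k t * (1 - k / 4 * chord k t) := by
  have h := chord_add k t t
  have h' := chord_sub k t t
  rw [sub_self, chord_zero, cs_eq] at h'
  linear_combination (1/2 : ℝ) * h'

lemma sn_pos {t : ℝ} (ht : 0 < t) (h : LtDiam k t) : 0 < sn k t := by
  cases k
  · simpa [sn] using ht
  · simpa [sn] using ht
  · exact Real.sin_pos_of_pos_of_lt_pi ht (h rfl)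

lemma sn_nonneg {t : ℝ} (ht : 0 ≤ t) (h : LeDiam k t) : 0 ≤ sn k t := by
  cases k
  · simpa [sn] using ht
  · simpa [sn] using ht
  · exact Real.sin_nonneg_of_nonneg_of_le_pi ht (h rfl)

lemma sn_half_strictMono {s t : ℝ} (hs : 0 ≤ s) (hst : s < t) (h : LeDiam k t) :
    sn k (s / 2) < sn k (t / 2) := by
  cases k
  · simp only [sn, id]; linarith
  · simp only [sn]; exact Real.sinh_lt_sinh.2 (by linarith)
  · simp only [sn]
    have := h rfl
    exact Real.sin_lt_sin_of_lt_of_le_pi_div_two (by linarith [Real.pi_pos]) (by linarith)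
      (by linarith)

lemma chord_strictMono {s t : ℝ} (hs : 0 ≤ s) (hst : s < t) (h : LeDiam k t) :
    chord k s < chord k t := by
  have h1 := sn_half_strictMono hs hst h
  have h0 : 0 ≤ sn k (s / 2) := sn_nonneg (by linarith) (fun hk => by have := h hk; linarith)
  unfold chord
  nlinarith

lemma chord_mono {s t : ℝ} (hs : 0 ≤ s) (hst : s ≤ t) (h : LeDiam k t) :
    chord k s ≤ chord k t := by
  rcases hst.eq_or_lt with rfl | h1
  · exact le_rfl
  · exact (chord_strictMono hs h1 h).le

lemma le_of_chord_le {s t : ℝ} (ht : 0 ≤ t) (h : LeDiam k s) (hc : chord k s ≤ chord k t) :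
    s ≤ t := by
  by_contra! hlt
  exact absurd hc (not_le.2 (chord_strictMono ht hlt h))

lemma lt_of_chord_lt {s t : ℝ} (ht : 0 ≤ t) (h : LeDiam k s)
    (hc : chord k s < chord k t) : s < t := by
  by_contra! hlt
  exact absurd hc (not_lt.2 (chord_mono ht hlt h))

lemma eq_of_chord_eq {s t : ℝ} (hs : 0 ≤ s) (ht : 0 ≤ t) (h : LeDiam k s) (h' : LeDiam k t)
    (hc : chord k s = chord k t) : s = t :=
  le_antisymm (le_of_chord_le ht h hc.le) (le_of_chord_le hs h' hc.ge)

/-- The chord of an arc longer than half a circle is that of the complementary arc. -/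
lemma chord_two_pi_sub (t : ℝ) : chord .pos (2 * Real.pi - t) = chord .pos t := by
  rw [chord_pos_sign, chord_pos_sign, Real.cos_two_pi_sub]

lemma neg_one_lt_cs {t : ℝ} (ht : 0 ≤ t) (h : LtDiam k t) : -1 < cs k t := by
  cases k
  · simp [cs]
  · simp only [cs]; linarith [Real.one_le_cosh t]
  · have h1 := h rfl
    have := Real.cos_lt_cos_of_nonneg_of_le_pi ht le_rfl h1
    simpa [cs] using this

lemma cs_pos (hk : k ≠ .pos) (t : ℝ) : 0 < cs k t := by
  cases k
  · simp [cs]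
  · simpa [cs] using Real.cosh_pos t
  · exact absurd rfl hk

/-! ### The model plane as a quadric in space -/

/-- The model plane of curvature `k ∈ {1, 0, -1}` as a quadric in `ℝ³`: the unit sphere, the
affine plane `z = 1`, or the upper sheet of the hyperboloid `z² - x² - y² = 1`. -/
@[ext] structure Pt (k : SignType) where
  x : ℝ
  y : ℝ
  z : ℝ
  eq : (k : ℝ) * (x ^ 2 + y ^ 2) + z ^ 2 = 1
  pos : k ≠ .pos → 0 < z

/-- The squared chordal distance. In the hyperbolic case it is the squared Minkowski length of
the difference; in the flat case the `z`-coordinates agree and it is the squared distance. -/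
def phi (u v : Pt k) : ℝ := (u.x - v.x) ^ 2 + (u.y - v.y) ^ 2 + k * (u.z - v.z) ^ 2

/-- The intrinsic distance, the length of an arc whose squared chord is `phi`. On the sphere
`phi ≤ 4`, so that `arcsin` is taken of a number in `[0, 1]`. -/
noncomputable def d (u v : Pt k) : ℝ := 2 * asn k (Real.sqrt (phi u v) / 2)

lemma Pt.z_eq_one (u : Pt .zero) : u.z = 1 := by
  have h := u.eq
  have h' := u.pos (by decide)
  simp at h
  rcases h with h | h <;> linarith

lemma phi_comm (u v : Pt k) : phi u v = phi v u := by unfold phi; ring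

lemma d_comm (u v : Pt k) : d u v = d v u := by unfold d; rw [phi_comm]

@[simp] lemma phi_self (u : Pt k) : phi u u = 0 := by simp [phi]

/-- The chord in terms of the ambient bilinear form; the flat case carries no information. -/
lemma phi_form (u v : Pt k) :
    k * phi u v = 2 * (k : ℝ) ^ 2 * (1 - (k * (u.x * v.x + u.y * v.y) + u.z * v.z)) := by
  have h1 := u.eq
  have h2 := v.eq
  have h3 := sign_cube k
  unfold phi
  linear_combination (k : ℝ) ^ 2 * h1 + (k : ℝ) ^ 2 * h2 +
    ((2 * (u.x * v.x + u.y * v.y)) - (u.x ^ 2 + u.y ^ 2) - (v.x ^ 2 + v.y ^ 2)) * h3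

lemma phi_nonneg (u v : Pt k) : 0 ≤ phi u v := by
  cases k
  · simp [phi]; positivity
  · have h1 := u.eq
    have h2 := v.eq
    have p1 := u.pos (by decide)
    have p2 := v.pos (by decide)
    simp [phi] at *
    have : u.x * v.x + u.y * v.y + 1 ≤ u.z * v.z := by
      refine (abs_le_of_sq_le_sq' ?_ (by positivity)).2
      have : (u.z * v.z) ^ 2 = (1 + u.x ^ 2 + u.y ^ 2) * (1 + v.x ^ 2 + v.y ^ 2) := by
        rw [mul_pow]
        have e1 : u.z ^ 2 = 1 + u.x ^ 2 + u.y ^ 2 := by linarith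
        have e2 : v.z ^ 2 = 1 + v.x ^ 2 + v.y ^ 2 := by linarith
        rw [e1, e2]
      rw [this]
      nlinarith [sq_nonneg (u.x * v.y - u.y * v.x), sq_nonneg (u.x - v.x), sq_nonneg (u.y - v.y)]
    nlinarith
  · simp [phi]; positivity

lemma phi_le_four (u v : Pt .pos) : phi u v ≤ 4 := by
  have h1 := u.eq
  have h2 := v.eq
  simp [phi] at *
  nlinarith [sq_nonneg (u.x + v.x), sq_nonneg (u.y + v.y), sq_nonneg (u.z + v.z)]

lemma sn_half_d (u v : Pt k) : sn k (d u v / 2) = Real.sqrt (phi u v) / 2 := by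
  have h : d u v / 2 = asn k (Real.sqrt (phi u v) / 2) := by unfold d; ring
  rw [h]
  cases k
  · rfl
  · exact Real.sinh_arsinh _
  · have h4 : Real.sqrt (phi u v) ≤ 2 := by
      rw [Real.sqrt_le_left (by norm_num)]
      linarith [phi_le_four u v]
    exact Real.sin_arcsin (by linarith [Real.sqrt_nonneg (phi u v)]) (by linarith)

lemma chord_d (u v : Pt k) : chord k (d u v) = phi u v := by
  unfold chord
  rw [sn_half_d, div_pow, Real.sq_sqrt (phi_nonneg u v)]
  ring

lemma d_nonneg (u v : Pt k) : 0 ≤ d u v := by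
  have h := Real.sqrt_nonneg (phi u v)
  unfold d
  cases k
  · simp only [asn, id]; linarith
  · simp only [asn]
    have := Real.arsinh_nonneg_iff.2 (by linarith : 0 ≤ Real.sqrt (phi u v) / 2)
    linarith
  · simp only [asn]
    have := Real.arcsin_nonneg.2 (by linarith : 0 ≤ Real.sqrt (phi u v) / 2)
    linarith

lemma d_le (u v : Pt k) : LeDiam k (d u v) := by
  rintro rfl
  unfold d
  simp only [asn]
  linarith [Real.arcsin_le_pi_div_two (Real.sqrt (phi u v) / 2)]

@[simp] lemma d_self (u : Pt k) : d u u = 0 :=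
  eq_of_chord_eq (d_nonneg u u) le_rfl (d_le u u) (fun _ => Real.pi_pos.le) (by simp [chord_d])

lemma d_eq_of_chord {u v : Pt k} {t : ℝ} (ht : 0 ≤ t) (h : LeDiam k t) (hc : phi u v = chord k t) :
    d u v = t :=
  eq_of_chord_eq (d_nonneg u v) ht (d_le u v) h (by rw [chord_d, hc])

lemma d_le_d {u v u' v' : Pt k} (h : phi u v ≤ phi u' v') : d u v ≤ d u' v' :=
  le_of_chord_le (d_nonneg _ _) (d_le _ _) (by simpa [chord_d] using h)

lemma phi_le_phi {u v u' v' : Pt k} (h : d u v ≤ d u' v') : phi u v ≤ phi u' v' := by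
  rw [← chord_d, ← chord_d]
  exact chord_mono (d_nonneg _ _) h (d_le _ _)

lemma phi_lt_phi {u v u' v' : Pt k} (h : d u v < d u' v') : phi u v < phi u' v' := by
  rw [← chord_d, ← chord_d]
  exact chord_strictMono (d_nonneg _ _) h (d_le _ _)

lemma cs_d (u v : Pt k) : cs k (d u v) = k * (u.x * v.x + u.y * v.y) + u.z * v.z := by
  rw [cs_eq, chord_d]
  have h := phi_form u v
  have h3 := sign_cube k
  cases k
  · simp [u.z_eq_one, v.z_eq_one]
  · simp at *; linarith
  · simp at *; linarith

/-! ### Polar coordinates -/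

/-- The base point `(0, 0, 1)`. -/
def pole (k : SignType) : Pt k := ⟨0, 0, 1, by simp, fun _ => one_pos⟩

/-- The point at distance `t` from the pole in the direction `(ξ, η)`. -/
noncomputable def polar (t ξ η : ℝ) (h : ξ ^ 2 + η ^ 2 = 1) : Pt k where
  x := sn k t * ξ
  y := sn k t * η
  z := cs k t
  eq := by
    have := cs_sq k t
    linear_combination this + k * sn k t ^ 2 * h
  pos := fun hk => cs_pos hk t

/-- The law of cosines. -/
lemma phi_polar (a r ξ η ξ' η' : ℝ) (h : ξ ^ 2 + η ^ 2 = 1) (h' : ξ' ^ 2 + η' ^ 2 = 1) :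
    phi (polar a ξ η h : Pt k) (polar r ξ' η' h') =
      chord k a + cs k a * chord k r - 2 * sn k a * sn k r * (ξ * ξ' + η * η') := by
  have ha := sn_sq k a
  have hr := sn_sq k r
  have ca := cs_eq k a
  have cr := cs_eq k r
  have h3 := sign_cube k
  simp only [phi, polar]
  rw [ca, cr]
  linear_combination (sn k a) ^ 2 * h + sn k r ^ 2 * h' + ha + hr +
    1 / 4 * (chord k a - chord k r) ^ 2 * h3

lemma phi_pole_polar (a ξ η : ℝ) (h : ξ ^ 2 + η ^ 2 = 1) :
    phi (pole k) (polar a ξ η h) = chord k a := by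
  have ha := sn_sq k a
  have ca := cs_eq k a
  have h3 := sign_cube k
  simp only [phi, polar, pole]
  rw [ca]
  linear_combination (sn k a) ^ 2 * h + ha + 1 / 4 * (chord k a) ^ 2 * h3

lemma d_pole_polar {a ξ η : ℝ} (h : ξ ^ 2 + η ^ 2 = 1) (ha : 0 ≤ a) (ha' : LeDiam k a) :
    d (pole k) (polar a ξ η h) = a :=
  d_eq_of_chord ha ha' (phi_pole_polar a ξ η h)

lemma exists_polar (v : Pt k) :
    ∃ ξ η, ∃ h : ξ ^ 2 + η ^ 2 = 1, v = polar (d (pole k) v) ξ η h := by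
  have hz : v.z = cs k (d (pole k) v) := by rw [cs_d]; simp [pole]
  have hxy : v.x ^ 2 + v.y ^ 2 = sn k (d (pole k) v) ^ 2 := by
    have h1 := v.eq
    have h2 := cs_sq k (d (pole k) v)
    rw [← hz] at h2
    cases k
    · have h3 := chord_d (pole .zero) v
      rw [chord_zero_sign] at h3
      change _ = d (pole .zero) v ^ 2
      rw [h3]
      simp [phi, pole]
    · simp at h1 h2 ⊢; linarith
    · simp at h1 h2 ⊢; linarith
  by_cases h0 : sn k (d (pole k) v) = 0
  · refine ⟨1, 0, by norm_num, ?_⟩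
    rw [h0] at hxy
    have hx : v.x = 0 := by nlinarith [sq_nonneg v.x, sq_nonneg v.y]
    have hy : v.y = 0 := by nlinarith [sq_nonneg v.x, sq_nonneg v.y]
    ext <;> simp [polar, h0, hx, hy, hz]
  · refine ⟨v.x / sn k (d (pole k) v), v.y / sn k (d (pole k) v), ?_, ?_⟩
    · field_simp; exact hxy
    · ext
      · simp only [polar]; field_simp
      · simp only [polar]; field_simp
      · simp only [polar]; exact hz

lemma polar_zero (ξ η : ℝ) (h : ξ ^ 2 + η ^ 2 = 1) : polar 0 ξ η h = pole k := by
  ext <;> simp [polar, pole]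

/-! ### Segments and motions -/

/-- `m` lies on the segment from `p` to `q`: as a vector it is a combination of `p` and `q` with
nonnegative coefficients. -/
def InSeg (m p q : Pt k) : Prop :=
  ∃ α β : ℝ, 0 ≤ α ∧ 0 ≤ β ∧ m.x = α * p.x + β * q.x ∧ m.y = α * p.y + β * q.y ∧
    m.z = α * p.z + β * q.z

lemma InSeg.symm {m p q : Pt k} (h : InSeg m p q) : InSeg m q p := by
  obtain ⟨α, β, h1, h2, hx, hy, hz⟩ := h
  exact ⟨β, α, h2, h1, by linarith, by linarith, by linarith⟩

lemma InSeg.left (p q : Pt k) : InSeg p p q := ⟨1, 0, by simp⟩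

lemma InSeg.right (p q : Pt k) : InSeg q p q := ⟨0, 1, by simp⟩

lemma InSeg.trans {m n p q : Pt k} (h : InSeg m p q) (h' : InSeg n p m) : InSeg n p q := by
  obtain ⟨α, β, h1, h2, hx, hy, hz⟩ := h
  obtain ⟨γ, δ, h3, h4, hx', hy', hz'⟩ := h'
  refine ⟨γ + δ * α, δ * β, by positivity, by positivity, ?_, ?_, ?_⟩
  · rw [hx', hx]; ring
  · rw [hy', hy]; ring
  · rw [hz', hz]; ring

/-- A motion of the model plane: a bijection that preserves chords and segments. -/
structure Motion (k : SignType) where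
  f : Pt k ≃ Pt k
  phi_map : ∀ u v, phi (f u) (f v) = phi u v
  seg : ∀ m p q, InSeg (f m) (f p) (f q) ↔ InSeg m p q

/-- Composition of motions. -/
def Motion.comp (S T : Motion k) : Motion k where
  f := T.f.trans S.f
  phi_map u v := by simp [S.phi_map, T.phi_map]
  seg m p q := by simp [S.seg, T.seg]

lemma Motion.d (T : Motion k) (u v : Pt k) : d (T.f u) (T.f v) = d u v := by
  unfold ModelGeometry.d; rw [T.phi_map]

/-- The rotation about the pole that moves the direction `(ξ, η)` to the `x`-axis. -/
def rot (k : SignType) (ξ η : ℝ) (h : ξ ^ 2 + η ^ 2 = 1) : Motion k where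
  f :=
    { toFun := fun u => ⟨ξ * u.x + η * u.y, -η * u.x + ξ * u.y, u.z, by
        linear_combination u.eq + k * (u.x ^ 2 + u.y ^ 2) * h, u.pos⟩
      invFun := fun u => ⟨ξ * u.x - η * u.y, η * u.x + ξ * u.y, u.z, by
        linear_combination u.eq + k * (u.x ^ 2 + u.y ^ 2) * h, u.pos⟩
      left_inv := fun u => by
        ext
        · simp only; linear_combination u.x * h
        · simp only; linear_combination u.y * h
        · rfl
      right_inv := fun u => by
        ext
        · simp only; linear_combination u.x * h
        · simp only; linear_combination u.y * h
        · rfl }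
  phi_map u v := by
    simp only [phi, Equiv.coe_fn_mk]
    linear_combination ((u.x - v.x) ^ 2 + (u.y - v.y) ^ 2) * h
  seg m p q := by
    simp only [InSeg, Equiv.coe_fn_mk]
    refine exists_congr fun α => exists_congr fun β => and_congr_right fun _ =>
      and_congr_right fun _ => ⟨fun ⟨h1, h2, h3⟩ => ⟨?_, ?_, h3⟩, fun ⟨h1, h2, h3⟩ => ⟨?_, ?_, h3⟩⟩
    · linear_combination ξ * h1 - η * h2 + (α * p.x + β * q.x - m.x) * h
    · linear_combination η * h1 + ξ * h2 + (α * p.y + β * q.y - m.y) * h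
    · linear_combination ξ * h1 + η * h2
    · linear_combination -η * h1 + ξ * h2

/-- A translation along the `x`-axis preserves the upper sheet `z > 0`. -/
lemma boost_pos (t : ℝ) (u : Pt k) (hk : k ≠ .pos) : 0 < -k * sn k t * u.x + cs k t * u.z := by
  have h1 := u.eq
  have h2 := cs_sq k t
  have hc := cs_pos hk t
  have hz := u.pos hk
  cases k
  · simp [cs, u.z_eq_one]
  · simp at h1 h2 ⊢
    have : (sn SignType.neg t * u.x) ^ 2 < (cs SignType.neg t * u.z) ^ 2 := by
      simp only [SignType.neg_eq_neg_one] at *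
      rw [mul_pow, mul_pow]
      have e1 : cs (-1) t ^ 2 = 1 + sn (-1) t ^ 2 := by linarith
      have e2 : u.z ^ 2 = 1 + u.x ^ 2 + u.y ^ 2 := by linarith
      rw [e1, e2]
      nlinarith [sq_nonneg (sn (-1) t), sq_nonneg u.x, sq_nonneg u.y,
        mul_nonneg (sq_nonneg (sn (-1) t)) (sq_nonneg u.y)]
    have := abs_lt_of_sq_lt_sq this (by positivity)
    have := (abs_lt.1 this).1
    simp only [SignType.neg_eq_neg_one] at *
    linarith
  · exact absurd rfl hk

/-- The translation by `t` along the `x`-axis: a rotation of the sphere, a translation of the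
plane, or a Lorentz boost. -/
noncomputable def boost (k : SignType) (t : ℝ) : Motion k where
  f :=
    { toFun := fun u => ⟨cs k t * u.x + sn k t * u.z, u.y, -k * sn k t * u.x + cs k t * u.z, by
        linear_combination u.eq + (k * u.x ^ 2 + u.z ^ 2) * cs_sq k t, boost_pos t u⟩
      invFun := fun u => ⟨cs k t * u.x - sn k t * u.z, u.y, k * sn k t * u.x + cs k t * u.z, by
        linear_combination u.eq + (k * u.x ^ 2 + u.z ^ 2) * cs_sq k t, fun hk => by
          simpa using boost_pos (-t) u hk⟩
      left_inv := fun u => by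
        ext
        · simp only; linear_combination u.x * cs_sq k t
        · rfl
        · simp only; linear_combination u.z * cs_sq k t
      right_inv := fun u => by
        ext
        · simp only; linear_combination u.x * cs_sq k t
        · rfl
        · simp only; linear_combination u.z * cs_sq k t }
  phi_map u v := by
    have h := cs_sq k t
    cases k
    · simp [phi, u.z_eq_one, v.z_eq_one, cs]
    · simp [phi] at *
      linear_combination ((u.x - v.x) ^ 2 - (u.z - v.z) ^ 2) * h
    · simp [phi] at *
      linear_combination ((u.x - v.x) ^ 2 + (u.z - v.z) ^ 2) * h
  seg m p q := by
    have h := cs_sq k t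
    simp only [InSeg, Equiv.coe_fn_mk]
    refine exists_congr fun α => exists_congr fun β => and_congr_right fun _ =>
      and_congr_right fun _ => ⟨fun ⟨h1, h2, h3⟩ => ⟨?_, h2, ?_⟩, fun ⟨h1, h2, h3⟩ => ⟨?_, h2, ?_⟩⟩
    · linear_combination cs k t * h1 - sn k t * h3 + (α * p.x + β * q.x - m.x) * h
    · linear_combination k * sn k t * h1 + cs k t * h3 + (α * p.z + β * q.z - m.z) * h
    · linear_combination cs k t * h1 + sn k t * h3
    · linear_combination -k * sn k t * h1 + cs k t * h3

/-- Every pair of points can be moved to the pole and a point of the positive `x`-axis. -/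
lemma exists_motion (p q : Pt k) :
    ∃ T : Motion k, T.f p = pole k ∧ T.f q = polar (d p q) 1 0 (by norm_num) := by
  obtain ⟨ξ, η, h, hp⟩ := exists_polar p
  set t := d (pole k) p
  let T₁ := (boost k (-t)).comp (rot k ξ η h)
  have h1 : T₁.f p = pole k := by
    have hc := cs_sq k t
    ext
    · simp only [T₁, Motion.comp, boost, rot, pole, Equiv.trans_apply, Equiv.coe_fn_mk]
      rw [hp]
      simp only [polar, sn_neg, cs_neg]
      linear_combination sn k t * cs k t * h
    · simp only [T₁, Motion.comp, boost, rot, pole, Equiv.trans_apply, Equiv.coe_fn_mk]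
      rw [hp]
      simp only [polar]
      ring
    · simp only [T₁, Motion.comp, boost, rot, pole, Equiv.trans_apply, Equiv.coe_fn_mk]
      rw [hp]
      simp only [polar, sn_neg, cs_neg]
      linear_combination hc + k * sn k t ^ 2 * h
  obtain ⟨ξ', η', h', hq⟩ := exists_polar (T₁.f q)
  have hd : d (pole k) (T₁.f q) = d p q := by rw [← h1, T₁.d]
  rw [hd] at hq
  refine ⟨(rot k ξ' η' h').comp T₁, ?_, ?_⟩
  · show (rot k ξ' η' h').f (T₁.f p) = _
    rw [h1]
    ext <;> simp [rot, pole]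
  · show (rot k ξ' η' h').f (T₁.f q) = _
    rw [hq]
    ext
    · simp only [rot, polar, Equiv.coe_fn_mk]; linear_combination sn k (d p q) * h'
    · simp only [rot, polar, Equiv.coe_fn_mk]; ring
    · rfl

lemma eq_of_d_eq_zero {p q : Pt k} (h : d p q = 0) : p = q := by
  obtain ⟨T, h1, h2⟩ := exists_motion p q
  rw [h, polar_zero] at h2
  exact T.f.injective (h1.trans h2.symm)

/-! ### Distances along segments -/

lemma abs_le_of_circle {ξ η : ℝ} (h : ξ ^ 2 + η ^ 2 = 1) : -1 ≤ ξ ∧ ξ ≤ 1 := by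
  constructor <;> nlinarith [sq_nonneg η]

lemma d_triangle (p q r : Pt k) : d p r ≤ d p q + d q r := by
  obtain ⟨T, h1, h2⟩ := exists_motion q p
  obtain ⟨ξ, η, h, hr⟩ := exists_polar (T.f r)
  have hd : d (pole k) (T.f r) = d q r := by rw [← h1, T.d]
  rw [hd] at hr
  have hp := phi_polar (k := k) (d q p) (d q r) 1 0 ξ η (by norm_num) h
  rw [← h2, ← hr, T.phi_map, ← chord_d] at hp
  have s1 := sn_nonneg (d_nonneg q p) (d_le q p)
  have s2 := sn_nonneg (d_nonneg q r) (d_le q r)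
  have hle : chord k (d p r) ≤ chord k (d q p + d q r) := by
    rw [chord_add, hp]
    nlinarith [mul_nonneg (mul_nonneg s1 s2) (by linarith [(abs_le_of_circle h).1] : 0 ≤ 1 + ξ)]
  rw [d_comm p q]
  exact le_of_chord_le (add_nonneg (d_nonneg _ _) (d_nonneg _ _)) (d_le _ _) hle

lemma InSeg.eq_of_self {m p : Pt k} (h : InSeg m p p) : m = p := by
  obtain ⟨α, β, h1, h2, hx, hy, hz⟩ := h
  have e1 := m.eq
  have e2 := p.eq
  have hs : (α + β) ^ 2 = 1 := by
    rw [hx, hy, hz] at e1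
    linear_combination e1 - (α + β) ^ 2 * e2
  have hs1 : α + β = 1 := by nlinarith
  have hα : α = 1 - β := by linarith
  ext
  · rw [hx, hα]; ring
  · rw [hy, hα]; ring
  · rw [hz, hα]; ring

lemma eq_of_smul {m p : Pt k} {α : ℝ} (h : 0 ≤ α) (hx : m.x = α * p.x) (hy : m.y = α * p.y)
    (hz : m.z = α * p.z) : m = p :=
  InSeg.eq_of_self ⟨α, 0, h, le_rfl, by simpa using hx, by simpa using hy, by simpa using hz⟩

lemma InSeg.d_add {m p q : Pt k} (h : InSeg m p q) (hs : LtDiam k (d p q)) :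
    d p m + d m q = d p q := by
  obtain ⟨T, h1, h2⟩ := exists_motion p q
  set c := d p q with hc
  rcases (d_nonneg p q).eq_or_lt with h0 | h0
  · have := eq_of_d_eq_zero h0.symm
    subst this
    have := h.eq_of_self
    subst this
    simp [hc]
  have hseg := (T.seg m p q).2 h
  obtain ⟨ξ, η, h3, hm⟩ := exists_polar (T.f m)
  have hd : d (pole k) (T.f m) = d p m := by rw [← h1, T.d]
  rw [hd] at hm
  set t := d p m with ht
  rw [hm, h1, h2] at hseg
  obtain ⟨α, β, hα, hβ, hx, hy, hz⟩ := hseg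
  simp only [polar, pole] at hx hy hz
  have hsc : 0 < sn k c := sn_pos h0 hs
  have hst : 0 ≤ sn k t := sn_nonneg (d_nonneg _ _) (d_le _ _)
  rcases hst.eq_or_lt with hst | hst
  · rw [← hst] at hx
    have hβ0 : β = 0 := by
      have : β * sn k c = 0 := by linarith
      rcases mul_eq_zero.1 this with h | h
      · exact h
      · linarith
    have hmp : T.f m = T.f p := by
      rw [h1]
      refine eq_of_smul hα ?_ ?_ ?_
      · rw [hm]; simp [polar, pole, ← hst]
      · rw [hm]; simp [polar, pole, ← hst]
      · rw [hm]; simp [polar, pole, hz, hβ0]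
    have := T.f.injective hmp
    subst this
    simp [hc, ht]
  · have hη : η = 0 := by
      have : sn k t * η = 0 := by linarith
      rcases mul_eq_zero.1 this with h | h
      · linarith
      · exact h
    have hξ0 : 0 ≤ ξ := by
      have : 0 ≤ sn k t * ξ := by rw [hx]; simp; positivity
      exact nonneg_of_mul_nonneg_right this hst
    have hξ : ξ = 1 := by subst hη; nlinarith
    subst hξ hη
    have hnn : 0 ≤ sn k (c - t) := by
      have : sn k (c - t) = α * sn k c := by
        rw [sn_sub]
        linear_combination sn k c * hz - cs k c * hx
      rw [this]; positivity
    have htc : t ≤ c := by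
      by_contra! hlt
      have : 0 < sn k (t - c) := sn_pos (by linarith) (fun hk => by
        have := d_le p m hk
        linarith)
      have h5 : sn k (c - t) = - sn k (t - c) := by rw [← sn_neg]; congr 1; ring
      linarith
    have hφ : phi m q = chord k (c - t) := by
      rw [← T.phi_map, hm, h2, phi_polar, chord_sub, chord_symm k c t]; ring
    have : d m q = c - t := d_eq_of_chord (by linarith)
      (fun hk => by have := hs hk; have := d_nonneg p m; linarith) hφ
    linarith

lemma inSeg_of_d_add {m p q : Pt k} (hs : LtDiam k (d p q)) (h : d p m + d m q = d p q) :
    InSeg m p q := by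
  obtain ⟨T, h1, h2⟩ := exists_motion p q
  rcases (d_nonneg p m).eq_or_lt with h0 | h0
  · have := eq_of_d_eq_zero h0.symm
    subst this
    exact InSeg.left _ _
  obtain ⟨ξ, η, h3, hm⟩ := exists_polar (T.f m)
  have hd : d (pole k) (T.f m) = d p m := by rw [← h1, T.d]
  rw [hd] at hm
  have hmq := d_nonneg m q
  have hsc : 0 < sn k (d p q) := sn_pos (by linarith) hs
  have hst : 0 < sn k (d p m) := sn_pos h0 (hs.mono (by linarith))
  have hφ : phi m q = chord k (d p q - d p m) := by rw [← chord_d]; congr 1; linarith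
  rw [← T.phi_map, hm, h2, phi_polar, chord_sub, chord_symm k (d p q)] at hφ
  have h5 : sn k (d p m) * sn k (d p q) * (1 - ξ) = 0 := by linarith
  have hξ : ξ = 1 := by
    rcases mul_eq_zero.1 h5 with h | h
    · have := mul_pos hst hsc
      linarith
    · linarith
  have hη : η = 0 := by subst hξ; nlinarith
  subst hξ hη
  rw [← T.seg, hm, h1, h2]
  have hα : 0 ≤ sn k (d p q - d p m) :=
    sn_nonneg (by linarith) (fun hk => by have := hs hk; linarith)
  refine ⟨sn k (d p q - d p m) / sn k (d p q), sn k (d p m) / sn k (d p q), by positivity,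
    by positivity, ?_, ?_, ?_⟩
  · simp only [polar, pole]; field_simp; ring
  · simp [polar, pole]
  · simp only [polar, pole]; rw [sn_sub]; field_simp; ring

/-- Stewart's theorem: the chord from a point of a segment to a third point, in terms of the
chords from the ends of the segment. -/
lemma stewart {m x y : Pt k} (z : Pt k) (h : InSeg m x y) (hs : LtDiam k (d x y)) :
    sn k (d x y) * phi m z =
      sn k (d m y) * (phi x z - phi x m) + sn k (d x m) * (phi y z - phi y m) := by
  have hadd := h.d_add hs
  obtain ⟨T, h1, h2⟩ := exists_motion m x
  obtain ⟨ξ', η', h3, hy⟩ := exists_polar (T.f y)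
  obtain ⟨ξ, η, h4, hz⟩ := exists_polar (T.f z)
  have hd : d (pole k) (T.f y) = d m y := by rw [← h1, T.d]
  have hd' : d (pole k) (T.f z) = d m z := by rw [← h1, T.d]
  rw [hd] at hy
  rw [hd'] at hz
  rw [phi_comm x m, phi_comm y m, ← chord_d m x, ← chord_d m y, ← chord_d m z]
  rw [d_comm x m] at *
  set s := d m x
  set t := d m y
  set r := d m z
  have exy : phi x y = chord k (s + t) := by rw [← chord_d]; congr 1; linarith
  have exz := T.phi_map x z
  have eyz := T.phi_map y z
  rw [← T.phi_map, hy, h2, phi_polar, chord_add] at exy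
  rw [h2, hz, phi_polar] at exz
  rw [hy, hz, phi_polar] at eyz
  rw [← exz, ← eyz, ← hadd, sn_add]
  have h5 : sn k s * sn k t * (1 + ξ') = 0 := by linarith
  rcases mul_eq_zero.1 h5 with h6 | h6
  · linear_combination (2 * sn k r * (ξ + ξ' * ξ + η' * η)) * h6
  · have hξ : ξ' = -1 := by linarith
    have hη : η' = 0 := by subst hξ; nlinarith
    subst hξ hη
    ring

/-- A cevian does not get shorter when the base and its subdivision are kept and the other two
sides do not get shorter. -/
lemma cevian_mono {m x y z m' x' y' z' : Pt k} (h : InSeg m x y) (h' : InSeg m' x' y')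
    (hs : LtDiam k (d x y)) (h1 : d x m = d x' m') (h2 : d m y = d m' y')
    (h3 : d x z ≤ d x' z') (h4 : d y z ≤ d y' z') (hs' : LtDiam k (d x' y')) : d m z ≤ d m' z' := by
  have e1 := h.d_add hs
  have e2 := h'.d_add hs'
  have hc : d x' y' = d x y := by linarith
  have n1 := d_nonneg x m
  have n2 := d_nonneg m y
  rcases (d_nonneg x y).eq_or_lt with h0 | h0
  · have a1 : x = m := eq_of_d_eq_zero (by linarith)
    have a2 : x' = m' := eq_of_d_eq_zero (by linarith)
    rw [← a1, ← a2]; exact h3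
  · have st := stewart z h hs
    have st' := stewart z' h' hs'
    have sc := sn_pos h0 hs
    have p1 : phi x m = phi x' m' := by rw [← chord_d, h1, chord_d]
    have p2 : phi y m = phi y' m' := by rw [← chord_d, d_comm, h2, d_comm, chord_d]
    rw [hc, ← h1, ← h2, ← p1, ← p2] at st'
    have s1 : 0 ≤ sn k (d m y) := sn_nonneg n2 (d_le _ _)
    have s2 : 0 ≤ sn k (d x m) := sn_nonneg n1 (d_le _ _)
    apply d_le_d
    have q1 := mul_le_mul_of_nonneg_left (phi_le_phi h3) s1
    have q2 := mul_le_mul_of_nonneg_left (phi_le_phi h4) s2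
    have : sn k (d x y) * phi m z ≤ sn k (d x y) * phi m' z' := by rw [st, st']; linarith
    exact le_of_mul_le_mul_left this sc

lemma cevian_strictMono {m x y z z' : Pt k} (h : InSeg m x y) (hs : LtDiam k (d x y))
    (hne : m ≠ x) (h3 : d x z ≤ d x z') (h4 : d y z < d y z') : d m z < d m z' := by
  have e1 := h.d_add hs
  have n1 : 0 < d x m := by
    rcases (d_nonneg x m).eq_or_lt with h0 | h0
    · exact absurd (eq_of_d_eq_zero h0.symm).symm hne
    · exact h0
  have n2 := d_nonneg m y
  have st := stewart z h hs
  have st' := stewart z' h hs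
  have sc : 0 < sn k (d x y) := sn_pos (by linarith) hs
  have s1 : 0 ≤ sn k (d m y) := sn_nonneg n2 (d_le _ _)
  have s2 : 0 < sn k (d x m) := sn_pos n1 (hs.mono (by linarith))
  have q1 := mul_le_mul_of_nonneg_left (phi_le_phi h3) s1
  have q2 := mul_lt_mul_of_pos_left (phi_lt_phi h4) s2
  have : sn k (d x y) * phi m z < sn k (d x y) * phi m z' := by rw [st, st']; linarith
  have := lt_of_mul_lt_mul_left this sc.le
  rw [← chord_d, ← chord_d] at this
  exact lt_of_chord_lt (d_nonneg _ _) (d_le _ _) this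

/-- Distances to the points of a segment are controlled by the distances to its ends. -/
lemma seg_mono {m p q w w' : Pt k} (h : InSeg m p q) (hs : LtDiam k (d p q))
    (h1 : d w' p ≤ d w p) (h2 : d w' q ≤ d w q) : d w' m ≤ d w m := by
  have := cevian_mono h h hs rfl rfl (z := w') (z' := w) (by rwa [d_comm, d_comm p])
    (by rwa [d_comm, d_comm q]) hs
  rwa [d_comm, d_comm m w] at this

/-- A nontrivial nonnegative combination of two non-antipodal points is a positive multiple of a
point. -/
lemma exists_normalize {p q : Pt k} (hs : LtDiam k (d p q)) {α β : ℝ} (hα : 0 ≤ α) (hβ : 0 ≤ β)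
    (hne : 0 < α + β) : ∃ m : Pt k, ∃ ρ : ℝ, 0 < ρ ∧ α * p.x + β * q.x = ρ * m.x ∧
      α * p.y + β * q.y = ρ * m.y ∧ α * p.z + β * q.z = ρ * m.z := by
  have hc := neg_one_lt_cs (d_nonneg p q) hs
  rw [cs_d] at hc
  -- the square length of the combination
  set N := k * ((α * p.x + β * q.x) ^ 2 + (α * p.y + β * q.y) ^ 2) + (α * p.z + β * q.z) ^ 2
    with hN
  have hNe : N = (α - β) ^ 2 + 2 * (α * β) * (1 + (k * (p.x * q.x + p.y * q.y) + p.z * q.z)) := by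
    rw [hN]
    linear_combination α ^ 2 * p.eq + β ^ 2 * q.eq
  have hNpos : 0 < N := by
    rw [hNe]
    rcases (mul_nonneg hα hβ).eq_or_lt with h0 | h0
    · rw [← h0]
      rcases mul_eq_zero.1 h0.symm with h | h
      · subst h; simp at hne ⊢; positivity
      · subst h; simp at hne ⊢; positivity
    · have : 0 < 1 + (k * (p.x * q.x + p.y * q.y) + p.z * q.z) := by linarith
      positivity
  have hr := Real.sqrt_pos.2 hNpos
  have hr2 := Real.sq_sqrt hNpos.le
  refine ⟨⟨(α * p.x + β * q.x) / √N, (α * p.y + β * q.y) / √N, (α * p.z + β * q.z) / √N, ?_, ?_⟩,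
    √N, hr, ?_, ?_, ?_⟩
  · field_simp
    rw [hr2]
  · intro hk
    have := p.pos hk
    have := q.pos hk
    apply div_pos _ hr
    rcases hα.eq_or_lt with h | h
    · have : 0 < β := by linarith
      positivity
    · positivity
  · simp only; field_simp
  · simp only; field_simp
  · simp only; field_simp

/-- Existence of a triangle with a given base and given lengths of the other sides. In suitable
coordinates its apex lies on the side of the base opposite to a given point `e`. -/
lemma exists_triangle_opposite (p q e : Pt k) {a b : ℝ} (h1 : d p q ≤ a + b) (h2 : a ≤ d p q + b)
    (h3 : b ≤ d p q + a) (hs : k = .pos → a + b + d p q < 2 * Real.pi) :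
    ∃ w, ∃ T : Motion k, T.f p = pole k ∧ T.f q = polar (d p q) 1 0 (by norm_num) ∧
      (T.f w).y * (T.f e).y ≤ 0 ∧ d w p = a ∧ d w q = b := by
  have hc := d_nonneg p q
  have ha : 0 ≤ a := by linarith
  have hb : 0 ≤ b := by linarith
  have ha' : LtDiam k a := fun hk => by have := hs hk; linarith
  have hb' : LtDiam k b := fun hk => by have := hs hk; linarith
  have hc' : LtDiam k (d p q) := fun hk => by have := hs hk; linarith
  obtain ⟨T, e1, e2⟩ := exists_motion p q
  set c := d p q with hcdef
  -- `ξ` is the cosine of the angle at `p`; it is determined by the law of cosines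
  have key : ∃ ξ : ℝ, -1 ≤ ξ ∧ ξ ≤ 1 ∧
      chord k b = chord k a + cs k a * chord k c - 2 * sn k a * sn k c * ξ := by
    rcases ha.eq_or_lt with h0 | h0
    · refine ⟨1, by norm_num, le_rfl, ?_⟩
      have : b = c := by linarith
      rw [← h0, this]; simp
    rcases hc.eq_or_lt with h0' | h0'
    · refine ⟨1, by norm_num, le_rfl, ?_⟩
      have : b = a := by linarith
      rw [← h0', this]; simp
    have sa := sn_pos h0 ha'
    have sc := sn_pos h0' hc'
    have hsc : 0 < 2 * sn k a * sn k c := by positivity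
    have u1 : chord k (a - c) ≤ chord k b := by
      rcases le_total a c with h | h
      · rw [← chord_neg]
        exact chord_mono (by linarith) (by linarith) hb'.le
      · exact chord_mono (by linarith) (by linarith) hb'.le
    have u2 : chord k b ≤ chord k (a + c) := by
      by_cases h : k = .pos ∧ Real.pi < a + c
      · obtain ⟨rfl, h⟩ := h
        rw [← chord_two_pi_sub (a + c)]
        have := hs rfl
        exact chord_mono hb (by linarith) (fun _ => by linarith)
      · exact chord_mono hb (by linarith) (fun hk => by
          by_contra! h'
          exact h ⟨hk, h'⟩)
    rw [chord_sub] at u1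
    rw [chord_add] at u2
    refine ⟨(chord k a + cs k a * chord k c - chord k b) / (2 * sn k a * sn k c), ?_, ?_, ?_⟩
    · rw [le_div_iff₀ hsc]; linarith
    · rw [div_le_iff₀ hsc]; linarith
    · field_simp; ring
  obtain ⟨ξ, hξ1, hξ2, hξ⟩ := key
  have hcirc : ∃ η : ℝ, ξ ^ 2 + η ^ 2 = 1 ∧ η * (T.f e).y ≤ 0 := by
    have h1 := Real.sq_sqrt (by nlinarith : 0 ≤ 1 - ξ ^ 2)
    have h2 := Real.sqrt_nonneg (1 - ξ ^ 2)
    rcases le_total 0 (T.f e).y with h | h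
    · exact ⟨-√(1 - ξ ^ 2), by rw [neg_sq, h1]; ring, by
        have := mul_nonneg h2 h
        linarith⟩
    · exact ⟨√(1 - ξ ^ 2), by rw [h1]; ring, mul_nonpos_of_nonneg_of_nonpos h2 h⟩
  obtain ⟨η, hη, hside⟩ := hcirc
  refine ⟨T.f.symm (polar a ξ η hη), T, e1, e2, ?_, ?_, ?_⟩
  · have := mul_nonpos_of_nonneg_of_nonpos (sn_nonneg ha ha'.le) hside
    simp only [Equiv.apply_symm_apply, polar]
    linarith
  · rw [d_comm, ← T.d, e1, Equiv.apply_symm_apply, d_pole_polar _ ha ha'.le]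
  · apply d_eq_of_chord hb hb'.le
    rw [← T.phi_map, e2, Equiv.apply_symm_apply, phi_polar, hξ]; ring

lemma exists_triangle (p q : Pt k) {a b : ℝ} (h1 : d p q ≤ a + b) (h2 : a ≤ d p q + b)
    (h3 : b ≤ d p q + a) (hs : k = .pos → a + b + d p q < 2 * Real.pi) :
    ∃ w, d w p = a ∧ d w q = b := by
  obtain ⟨w, -, -, -, -, e1, e2⟩ := exists_triangle_opposite p q p h1 h2 h3 hs
  exact ⟨w, e1, e2⟩

/-- The point of a segment at a prescribed distance from its ends. -/
lemma exists_between {p q : Pt k} {s t : ℝ} (hs0 : 0 ≤ s) (ht0 : 0 ≤ t) (h : d p q = s + t)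
    (hs : LtDiam k (d p q)) : ∃ m, InSeg m p q ∧ d p m = s ∧ d m q = t := by
  obtain ⟨w, h1, h2⟩ := exists_triangle p q (a := s) (b := t) h.le
    (by linarith) (by linarith) (fun hk => by have := hs hk; linarith)
  refine ⟨w, inSeg_of_d_add hs ?_, by rwa [d_comm], h2⟩
  rw [d_comm p w]; linarith

/-- A segment can be prolonged. -/
lemma exists_extension (p q : Pt k) {a : ℝ} (ha : 0 ≤ a) (hs : LtDiam k (a + d p q)) :
    ∃ w, d w p = a ∧ d w q = a + d p q := by
  have := d_nonneg p q
  obtain ⟨w, h1, h2⟩ := exists_triangle p q (a := a) (b := a + d p q)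
    (by linarith) (by linarith) (by linarith) (fun hk => by have := hs hk; linarith)
  exact ⟨w, h1, h2⟩

/-- Pasch's axiom: if `[a, c]` meets the sides `[b, p]` and `[b, q]` of a triangle, it meets every
cevian `[b, m]`. -/
lemma pasch {a b c p q m x y : Pt k} (hx : InSeg x a c) (hy : InSeg y a c) (hxb : InSeg x b p)
    (hyb : InSeg y b q) (hm : InSeg m p q) (hac : LtDiam k (d a c)) :
    ∃ z, InSeg z a c ∧ InSeg z b m := by
  obtain ⟨α₁, β₁, nα₁, nβ₁, x1, y1, z1⟩ := hx
  obtain ⟨α₂, β₂, nα₂, nβ₂, x2, y2, z2⟩ := hy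
  obtain ⟨α, β, nα, nβ, x3, y3, z3⟩ := hxb
  obtain ⟨γ, δ, nγ, nδ, x4, y4, z4⟩ := hyb
  obtain ⟨ε, ζ, nε, nζ, x5, y5, z5⟩ := hm
  rcases nβ.eq_or_lt with h | hβ
  · have : x = b := eq_of_smul nα (by rw [x3, ← h]; ring) (by rw [y3, ← h]; ring)
      (by rw [z3, ← h]; ring)
    subst this
    exact ⟨x, ⟨α₁, β₁, nα₁, nβ₁, x1, y1, z1⟩, InSeg.left _ _⟩
  rcases nδ.eq_or_lt with h | hδ
  · have : y = b := eq_of_smul nγ (by rw [x4, ← h]; ring) (by rw [y4, ← h]; ring)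
      (by rw [z4, ← h]; ring)
    subst this
    exact ⟨y, ⟨α₂, β₂, nα₂, nβ₂, x2, y2, z2⟩, InSeg.left _ _⟩
  have hne : ∀ {u v w : Pt k} {α β : ℝ}, 0 ≤ α → 0 ≤ β → u.x = α * v.x + β * w.x →
      u.y = α * v.y + β * w.y → u.z = α * v.z + β * w.z → 0 < α + β := by
    intro u v w α β hα hβ hx hy hz
    by_contra! h
    have ha0 : α = 0 := by linarith
    have hb0 : β = 0 := by linarith
    have e := u.eq
    rw [hx, hy, hz, ha0, hb0] at e
    norm_num at e
  have n1 := hne nα₁ nβ₁ x1 y1 z1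
  have n2 := hne nα₂ nβ₂ x2 y2 z2
  have n5 := hne nε nζ x5 y5 z5
  -- the combination of `x` and `y` with coefficients `ε δ` and `ζ β` lies in the cone over
  -- `[b, m]`, and also in the cone over `[a, c]`
  set A := ε * δ * α₁ + ζ * β * α₂ with hA
  set B := ε * δ * β₁ + ζ * β * β₂ with hB
  have hAB : 0 < A + B := by
    have : A + B = ε * δ * (α₁ + β₁) + ζ * β * (α₂ + β₂) := by rw [hA, hB]; ring
    rw [this]
    rcases nε.eq_or_lt with h | h
    · have : 0 < ζ := by linarith
      positivity
    · positivity
  obtain ⟨z, ρ, hρ, zx, zy, zz⟩ := exists_normalize hac (α := A) (β := B) (by positivity)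
    (by positivity) hAB
  refine ⟨z, ⟨A / ρ, B / ρ, by positivity, by positivity, ?_, ?_, ?_⟩,
    ⟨(ε * δ * α + ζ * β * γ) / ρ, β * δ / ρ, by positivity, by positivity, ?_, ?_, ?_⟩⟩
  · field_simp; linarith
  · field_simp; linarith
  · field_simp; linarith
  · field_simp
    linear_combination -zx + ε * δ * (x3 - x1) + ζ * β * (x4 - x2) - β * δ * x5
  · field_simp
    linear_combination -zy + ε * δ * (y3 - y1) + ζ * β * (y4 - y2) - β * δ * y5
  · field_simp
    linear_combination -zz + ε * δ * (z3 - z1) + ζ * β * (z4 - z2) - β * δ * z5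

/-! ### Comparison of quadrilaterals -/

lemma d_le_of_le_cos {u v : Pt .pos} {t : ℝ} (ht : 0 ≤ t) (h : Real.cos t ≤ cs .pos (d u v)) :
    d u v ≤ t := by
  refine le_of_chord_le ht (d_le u v) ?_
  rw [chord_pos_sign, chord_pos_sign]
  simp only [cs] at h
  linarith

/-- Spherical case of `cross_le`, for two radii `e₁`, `e₂` with nondegenerate angle sum: the
vector `sin (e₁ + e₂) • (α p₀ + β p₂) - sin e₂ • p₁ - sin e₁ • p₃` has nonnegative square length,
and all terms but the one with `p₁` and `p₃` are controlled. -/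
lemma cross_le_sphere_aux {g₀ g₁ g₂ g₃ p₀ p₁ p₂ p₃ m : Pt .pos} (hm : InSeg m g₀ g₂)
    (h02 : d g₀ g₂ ≤ d p₀ p₂) (h01 : d p₀ p₁ ≤ d g₀ g₁) (h21 : d p₂ p₁ ≤ d g₂ g₁)
    (h03 : d p₀ p₃ ≤ d g₀ g₃) (h23 : d p₂ p₃ ≤ d g₂ g₃) {e₁ e₂ : ℝ} (he₁ : 0 < e₁) (he₂ : 0 < e₂)
    (he : e₁ + e₂ < Real.pi) (l1 : d g₁ m ≤ e₁) (l2 : d m g₃ ≤ e₂) : d p₁ p₃ ≤ e₁ + e₂ := by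
  obtain ⟨α, β, hα, hβ, hx, hy, hz⟩ := hm
  have cc : ∀ u v : Pt .pos, Real.cos (d u v) = u.x * v.x + u.y * v.y + u.z * v.z := by
    intro u v
    have := cs_d u v
    simpa [cs] using this
  have anti : ∀ {s t : ℝ}, 0 ≤ s → t ≤ Real.pi → s ≤ t → Real.cos t ≤ Real.cos s :=
    fun h1 h2 h3 => Real.cos_le_cos_of_nonneg_of_le_pi h1 h2 h3
  have k02 := anti (d_nonneg _ _) (d_le _ _ rfl) h02
  have k01 := anti (d_nonneg _ _) (d_le _ _ rfl) h01
  have k21 := anti (d_nonneg _ _) (d_le _ _ rfl) h21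
  have k03 := anti (d_nonneg _ _) (d_le _ _ rfl) h03
  have k23 := anti (d_nonneg _ _) (d_le _ _ rfl) h23
  have k1 := anti (d_nonneg _ _) (by linarith) l1
  have k2 := anti (d_nonneg _ _) (by linarith) l2
  rw [cc] at k1 k2
  rw [cc, cc] at k02 k01 k21 k03 k23
  have s1 := Real.sin_pos_of_pos_of_lt_pi he₁ (by linarith)
  have s2 := Real.sin_pos_of_pos_of_lt_pi he₂ (by linarith)
  have s3 := Real.sin_pos_of_pos_of_lt_pi (by linarith : 0 < e₁ + e₂) he
  have hS := Real.sin_add e₁ e₂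
  have hC := Real.cos_add e₁ e₂
  have q1 := Real.sin_sq_add_cos_sq e₁
  have q2 := Real.sin_sq_add_cos_sq e₂
  refine d_le_of_le_cos (by linarith) ?_
  simp only [cs]
  rw [cc]
  rw [hx, hy, hz] at k1 k2
  have em := m.eq
  rw [hx, hy, hz] at em
  have eg0 := g₀.eq
  have eg2 := g₂.eq
  have ep0 := p₀.eq
  have ep2 := p₂.eq
  have ep1 := p₁.eq
  have ep3 := p₃.eq
  simp only [SignType.pos_eq_one, SignType.coe_one, one_mul] at em eg0 eg2 ep0 ep1 ep2 ep3
  set S := Real.sin (e₁ + e₂)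
  set γ := Real.sin e₂
  set δ := Real.sin e₁
  set C₁ := Real.cos e₁
  set C₂ := Real.cos e₂
  set C := Real.cos (e₁ + e₂)
  -- the norm of `α p₀ + β p₂` is at most one
  have n1 : (α * p₀.x + β * p₂.x) ^ 2 + (α * p₀.y + β * p₂.y) ^ 2 + (α * p₀.z + β * p₂.z) ^ 2
      ≤ 1 := by
    have := mul_le_mul_of_nonneg_left k02 (mul_nonneg hα hβ)
    linear_combination 2 * this + em + α ^ 2 * ep0 + β ^ 2 * ep2 - α ^ 2 * eg0 - β ^ 2 * eg2
  have u1 : C₁ ≤ (α * p₀.x + β * p₂.x) * p₁.x + (α * p₀.y + β * p₂.y) * p₁.y +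
      (α * p₀.z + β * p₂.z) * p₁.z := by
    have a1 := mul_le_mul_of_nonneg_left k01 hα
    have a2 := mul_le_mul_of_nonneg_left k21 hβ
    linear_combination k1 + a1 + a2
  have u3 : C₂ ≤ (α * p₀.x + β * p₂.x) * p₃.x + (α * p₀.y + β * p₂.y) * p₃.y +
      (α * p₀.z + β * p₂.z) * p₃.z := by
    have a1 := mul_le_mul_of_nonneg_left k03 hα
    have a2 := mul_le_mul_of_nonneg_left k23 hβ
    linear_combination k2 + a1 + a2
  have hsq := add_nonneg (add_nonneg
    (sq_nonneg (S * (α * p₀.x + β * p₂.x) - γ * p₁.x - δ * p₃.x))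
    (sq_nonneg (S * (α * p₀.y + β * p₂.y) - γ * p₁.y - δ * p₃.y)))
    (sq_nonneg (S * (α * p₀.z + β * p₂.z) - γ * p₁.z - δ * p₃.z))
  have v0 := mul_le_mul_of_nonneg_left n1 (sq_nonneg S)
  have v1 := mul_le_mul_of_nonneg_left u1 (mul_pos s3 s2).le
  have v3 := mul_le_mul_of_nonneg_left u3 (mul_pos s3 s1).le
  have hSid : S ^ 2 = γ ^ 2 + δ ^ 2 + 2 * (γ * δ) * C := by
    rw [hS, hC]
    linear_combination γ ^ 2 * q1 + δ ^ 2 * q2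
  have hfin : γ * δ * C ≤ γ * δ * (p₁.x * p₃.x + p₁.y * p₃.y + p₁.z * p₃.z) := by
    have hS2 : S * γ * C₁ + S * δ * C₂ = S ^ 2 := by
      rw [sq S]; nth_rewrite 4 [hS]; ring
    linear_combination (1/2 : ℝ) * hsq + (1/2 : ℝ) * v0 + v1 + v3 + (1/2 : ℝ) * γ ^ 2 * ep1 +
      (1/2 : ℝ) * δ ^ 2 * ep3 - (1/2 : ℝ) * hSid - hS2
  exact le_of_mul_le_mul_left hfin (mul_pos s2 s1)

/-- Let `m` be a point of the diagonal `[g₀, g₂]`. If a quadrilateral `p` has sides not longer than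
those of `g` and its diagonal `p₀p₂` is not shorter, then its other diagonal is not longer than the
broken line from `g₁` to `g₃` through `m`. -/
lemma cross_le {g₀ g₁ g₂ g₃ p₀ p₁ p₂ p₃ m : Pt k} (hm : InSeg m g₀ g₂)
    (h02 : d g₀ g₂ ≤ d p₀ p₂) (h01 : d p₀ p₁ ≤ d g₀ g₁) (h21 : d p₂ p₁ ≤ d g₂ g₁)
    (h03 : d p₀ p₃ ≤ d g₀ g₃) (h23 : d p₂ p₃ ≤ d g₂ g₃) : d p₁ p₃ ≤ d g₁ m + d m g₃ := by
  by_cases hk : k = .pos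
  · subst hk
    by_contra! hlt
    have h1 := d_le p₁ p₃ rfl
    have n1 := d_nonneg g₁ m
    have n2 := d_nonneg m g₃
    have := cross_le_sphere_aux hm h02 h01 h21 h03 h23
      (e₁ := d g₁ m + (d p₁ p₃ - (d g₁ m + d m g₃)) / 4)
      (e₂ := d m g₃ + (d p₁ p₃ - (d g₁ m + d m g₃)) / 4) (by linarith) (by linarith)
      (by linarith) (by linarith) (by linarith)
    linarith
  · obtain ⟨α, β, hα, hβ, hx, hy, hz⟩ := hm
    have hαβ : 0 < α + β := by
      by_contra! h
      have ha0 : α = 0 := by linarith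
      have hb0 : β = 0 := by linarith
      have e := m.eq
      rw [hx, hy, hz, ha0, hb0] at e
      norm_num at e
    -- `m'` divides `[p₀, p₂]` as `m` divides `[g₀, g₂]`, and both halves of the broken line
    -- through `m'` are at most those of the broken line through `m`
    obtain ⟨m', ρ, hρ, mx, my, mz⟩ := exists_normalize (p := p₀) (q := p₂)
      (fun h => absurd h hk) hα hβ hαβ
    have key : ∀ g p : Pt k, d p₀ p ≤ d g₀ g → d p₂ p ≤ d g₂ g → d p m' ≤ d g m := by
      intro g p h1 h2
      apply d_le_d
      have f02 := phi_le_phi h02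
      have f1 := mul_le_mul_of_nonneg_left (phi_le_phi h1) hα
      have f2 := mul_le_mul_of_nonneg_left (phi_le_phi h2) hβ
      have f0 := mul_le_mul_of_nonneg_left f02 (mul_nonneg hα hβ)
      have em := m.eq
      have em' := m'.eq
      cases k
      · have hz' := hz
        simp only [Pt.z_eq_one] at hz'
        have mz' := mz
        simp only [Pt.z_eq_one] at mz'
        have hρ1 : ρ = 1 := by linarith
        subst hρ1
        simp only [phi, SignType.zero_eq_zero, SignType.coe_zero, zero_mul, add_zero, one_mul] at *
        have hα' : α = 1 - β := by linarith
        rw [← mx, ← my, hx, hy]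
        subst hα'
        linear_combination f1 + f2 + f0
      · have w1 := phi_form p m'
        have w2 := phi_form g m
        have w3 := phi_form p₀ p
        have w4 := phi_form g₀ g
        have w5 := phi_form p₂ p
        have w6 := phi_form g₂ g
        have w7 := phi_form p₀ p₂
        have w8 := phi_form g₀ g₂
        have eg0 := g₀.eq
        have eg2 := g₂.eq
        have ep0 := p₀.eq
        have ep2 := p₂.eq
        have nn := phi_nonneg p m'
        have nn2 := phi_nonneg p₀ p₂
        simp only [SignType.neg_eq_neg_one, SignType.coe_neg_one] at *
        have hρ2 : 1 ≤ ρ ^ 2 := by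
          have e1 : ρ ^ 2 = -1 * ((α * p₀.x + β * p₂.x) ^ 2 + (α * p₀.y + β * p₂.y) ^ 2) +
              (α * p₀.z + β * p₂.z) ^ 2 := by
            rw [mx, my, mz]; linear_combination -ρ ^ 2 * em'
          rw [hx, hy, hz] at em
          have e2 : ρ ^ 2 = α ^ 2 + β ^ 2 + 2 * (α * β) + (α * β) * phi p₀ p₂ := by
            rw [e1]; linear_combination α ^ 2 * ep0 + β ^ 2 * ep2 + α * β * w7
          have e3 : 1 = α ^ 2 + β ^ 2 + 2 * (α * β) + (α * β) * phi g₀ g₂ := by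
            linear_combination -em + α ^ 2 * eg0 + β ^ 2 * eg2 + α * β * w8
          linarith
        have hρ1 : 1 ≤ ρ := (one_le_sq_iff₀ hρ.le).1 hρ2
        have c1 : ρ * (1 + phi p m' / 2) = α * (1 + phi p₀ p / 2) + β * (1 + phi p₂ p / 2) := by
          linear_combination -ρ / 2 * w1 + α / 2 * w3 + β / 2 * w5 + p.x * mx + p.y * my - p.z * mz
        have c2 : 1 + phi g m / 2 = α * (1 + phi g₀ g / 2) + β * (1 + phi g₂ g / 2) := by
          rw [hx, hy, hz] at w2
          linear_combination -1 / 2 * w2 + α / 2 * w4 + β / 2 * w6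
        have c3 := mul_le_mul_of_nonneg_right hρ1 (by linarith : 0 ≤ 1 + phi p m' / 2)
        linarith
      · exact absurd rfl hk
    have a1 := key g₁ p₁ h01 h21
    have a3 := key g₃ p₃ h03 h23
    have := d_triangle p₁ m' p₃
    rw [d_comm m' p₃] at this
    rw [d_comm m g₃]
    linarith

/-! ### Gluing a triangle along an edge -/

/-- The triangles `wpq` and `ypq`, glued along `[p, q]`, have a reflex or straight angle at `p`:
prolonging `[y, p]` beyond `p` by the length of `[p, w]` gives a point `w'` that is not farther
from `q` than `w`. -/
def Refl (w p q y : Pt k) : Prop :=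
  ∃ w', d w' p = d w p ∧ d w' q ≤ d w q ∧ d w' y = d w' p + d p y

/-- The segments `[w, y]` and `[p, q]` meet. -/
def Cross (w y p q : Pt k) : Prop := ∃ m, InSeg m w y ∧ InSeg m p q

lemma Refl.of_motion (T : Motion k) {w p q y : Pt k}
    (h : Refl (T.f w) (T.f p) (T.f q) (T.f y)) : Refl w p q y := by
  obtain ⟨w', h1, h2, h3⟩ := h
  refine ⟨T.f.symm w', ?_, ?_, ?_⟩
  · rw [← T.d, Equiv.apply_symm_apply, h1, T.d]
  · rw [← T.d, Equiv.apply_symm_apply, ← T.d w]; exact h2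
  · rw [← T.d, ← T.d _ p, Equiv.apply_symm_apply, h3, T.d p]

lemma Cross.of_motion (T : Motion k) {w y p q : Pt k}
    (h : Cross (T.f w) (T.f y) (T.f p) (T.f q)) : Cross w y p q := by
  obtain ⟨m, h1, h2⟩ := h
  refine ⟨T.f.symm m, ?_, ?_⟩
  · rw [← T.seg, Equiv.apply_symm_apply]; exact h1
  · rw [← T.seg, Equiv.apply_symm_apply]; exact h2

/-- If the angle at the pole is not reflex, the combination of `w` and `y` that lies on the base
line lies on the positive side of the pole. -/
lemma refl_or_nonneg (w y : Pt k) {c : ℝ} (hc : 0 ≤ c) (hs : LtDiam k c)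
    (hper : k = .pos → d w (pole k) + d (pole k) y + d y (polar c 1 0 (by norm_num)) +
      d w (polar c 1 0 (by norm_num)) < 2 * Real.pi) :
    Refl w (pole k) (polar c 1 0 (by norm_num)) y ∨
      (0 ≤ |y.y| * w.x + |w.y| * y.x ∧ (w.y = 0 → 0 ≤ w.x)) := by
  obtain ⟨ξ, η, h1, hw⟩ := exists_polar w
  obtain ⟨ξ', η', h2, hy⟩ := exists_polar y
  have da := d_nonneg (pole k) w
  have da' := d_le (pole k) w
  have dr := d_nonneg (pole k) y
  have dr' := d_le (pole k) y
  have sa := sn_nonneg da da'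
  have sr := sn_nonneg dr dr'
  have sc := sn_nonneg hc hs.le
  rw [d_comm w (pole k)] at hper
  set a := d (pole k) w with hadef
  set r := d (pole k) y with hrdef
  by_cases hξ : ξ + ξ' ≤ 0
  · left
    have h3 : (-ξ') ^ 2 + (-η') ^ 2 = 1 := by linarith
    set u : Pt k := polar a (-ξ') (-η') h3 with hu
    have e1 : d u (pole k) = a := by rw [d_comm]; exact d_pole_polar h3 da da'
    have e2 : d u (polar c 1 0 (by norm_num)) ≤ d w (polar c 1 0 (by norm_num)) := by
      apply d_le_d
      rw [hw, hu, phi_polar, phi_polar]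
      have : 0 ≤ sn k a * sn k c * -(ξ + ξ') :=
        mul_nonneg (mul_nonneg sa sc) (by linarith)
      linarith
    have e3 : phi u y = chord k (a + r) := by
      rw [hy, hu, phi_polar, chord_add]
      linear_combination (2 * sn k a * sn k r) * h2
    refine ⟨u, by rw [e1, d_comm w], e2, ?_⟩
    rw [e1, ← hrdef]
    refine d_eq_of_chord (by linarith) ?_ e3
    rintro rfl
    by_contra! hlt
    -- past the antipode the perimeter would be too long
    have e4 : d u y = 2 * Real.pi - (a + r) := by
      refine d_eq_of_chord ?_ (fun _ => by linarith) (by rw [e3, chord_two_pi_sub])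
      have := da' rfl
      have := dr' rfl
      linarith
    have := d_triangle u (polar c 1 0 (by norm_num)) y
    have := hper rfl
    rw [d_comm y] at this
    linarith
  · right
    push Not at hξ
    constructor
    · rw [hw, hy]
      simp only [polar]
      rw [abs_mul, abs_mul, abs_of_nonneg sa, abs_of_nonneg sr]
      have key : 0 ≤ |η'| * ξ + |η| * ξ' := by
        have n1 := abs_nonneg η
        have n2 := abs_nonneg η'
        rcases le_total 0 ξ with hx | hx
        · rcases le_total 0 ξ' with hx' | hx'
          · positivity
          · have : |η| ≤ |η'| := sq_le_sq.1 (by nlinarith)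
            nlinarith
        · have : |η'| ≤ |η| := sq_le_sq.1 (by nlinarith)
          nlinarith
      have := mul_nonneg (mul_nonneg sa sr) key
      linarith
    · intro h0
      rw [hw] at h0 ⊢
      simp only [polar] at h0 ⊢
      rcases mul_eq_zero.1 h0 with h | h
      · rw [h]; simp
      · have hx : 0 ≤ ξ := by
          have := (abs_le_of_circle h2).2
          by_contra! hlt
          subst h
          nlinarith
        positivity

/-- The motion that exchanges the pole and the point at distance `c` on the `x`-axis. -/
noncomputable def swap (k : SignType) (c : ℝ) : Motion k :=
  (rot k (-1) 0 (by norm_num)).comp (boost k (-c))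

lemma swap_apply (c : ℝ) (u : Pt k) : ((swap k c).f u).x = sn k c * u.z - cs k c * u.x ∧
    ((swap k c).f u).y = -u.y := by
  constructor
  · simp only [swap, Motion.comp, rot, boost, Equiv.trans_apply, Equiv.coe_fn_mk, sn_neg, cs_neg]
    ring
  · simp only [swap, Motion.comp, rot, boost, Equiv.trans_apply, Equiv.coe_fn_mk]
    ring

lemma swap_pole (c : ℝ) : (swap k c).f (pole k) = polar c 1 0 (by norm_num) := by
  ext <;> simp [swap, Motion.comp, rot, boost, pole, polar]

lemma swap_polar (c : ℝ) : (swap k c).f (polar c 1 0 (by norm_num)) = pole k := by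
  ext
  · simp [swap, Motion.comp, rot, boost, pole, polar]; ring
  · simp [swap, Motion.comp, rot, boost, pole, polar]
  · simp [swap, Motion.comp, rot, boost, pole, polar]
    linear_combination cs_sq k c

/-- Two triangles on different sides of their common base: either their apexes are joined by a
segment across the base, or the angle at one of the ends of the base is reflex. -/
lemma cross_or_refl_normal (w y : Pt k) {c : ℝ} (hc : 0 < c) (hs : LtDiam k c)
    (hside : w.y * y.y ≤ 0)
    (hper : k = .pos → d w (pole k) + d (pole k) y + d y (polar c 1 0 (by norm_num)) +
      d w (polar c 1 0 (by norm_num)) < 2 * Real.pi) :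
    Cross w y (pole k) (polar c 1 0 (by norm_num)) ∨
      Refl w (pole k) (polar c 1 0 (by norm_num)) y ∨
      Refl w (polar c 1 0 (by norm_num)) (pole k) y := by
  rcases refl_or_nonneg w y hc.le hs hper with h | ⟨hx, hx0⟩
  · exact Or.inr (Or.inl h)
  have hsw := refl_or_nonneg ((swap k c).f w) ((swap k c).f y) hc.le hs (by
    intro hk
    have := hper hk
    have f1 : ∀ v, d ((swap k c).f v) (pole k) = d v (polar c 1 0 (by norm_num)) := fun v => by
      rw [← swap_polar c, Motion.d]
    have f2 : ∀ v, d ((swap k c).f v) (polar c 1 0 (by norm_num)) = d v (pole k) := fun v => by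
      rw [← swap_pole c, Motion.d]
    rw [d_comm (pole k) ((swap k c).f y), f1, f1, f2, f2, d_comm y (pole k)]
    linarith)
  rcases hsw with h | ⟨hz, hz0⟩
  · right; right
    apply Refl.of_motion (swap k c)
    rw [swap_polar, swap_pole]
    exact h
  left
  rw [(swap_apply c w).1, (swap_apply c w).2, (swap_apply c y).1, (swap_apply c y).2,
    abs_neg, abs_neg] at hz
  rw [(swap_apply c w).1, (swap_apply c w).2, neg_eq_zero] at hz0
  have sc := sn_pos hc hs
  have seg : ∀ m : Pt k, m.y = 0 → 0 ≤ m.x → 0 ≤ sn k c * m.z - cs k c * m.x →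
      InSeg m (pole k) (polar c 1 0 (by norm_num)) := by
    intro m h1 h2 h3
    refine ⟨(sn k c * m.z - cs k c * m.x) / sn k c, m.x / sn k c, by positivity, by positivity,
      ?_, ?_, ?_⟩
    · simp only [pole, polar]; field_simp; ring
    · simp only [pole, polar, h1]; ring
    · simp only [pole, polar]; field_simp; ring
  rcases (add_nonneg (abs_nonneg y.y) (abs_nonneg w.y)).eq_or_lt with h0 | h0
  · have hw : w.y = 0 := abs_eq_zero.1 (by linarith [abs_nonneg y.y, abs_nonneg w.y])
    exact ⟨w, InSeg.left _ _, seg w hw (hx0 hw) (hz0 hw)⟩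
  · have hwy : LtDiam k (d w y) := by
      intro hk
      have h1 := d_triangle w (pole k) y
      have h2 := d_triangle w (polar c 1 0 (by norm_num)) y
      rw [d_comm (polar c 1 0 _) y] at h2
      have := hper hk
      linarith
    obtain ⟨m, ρ, hρ, mx, my, mz⟩ := exists_normalize hwy (abs_nonneg y.y) (abs_nonneg w.y) h0
    refine ⟨m, ⟨|y.y| / ρ, |w.y| / ρ, by positivity, by positivity, ?_, ?_, ?_⟩, seg m ?_ ?_ ?_⟩
    · field_simp; linarith
    · field_simp; linarith
    · field_simp; linarith
    · have : ρ * m.y = 0 := by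
        rw [← my]
        rcases le_total 0 w.y with h | h <;> rcases le_total 0 y.y with h' | h'
        · rw [abs_of_nonneg h, abs_of_nonneg h']; nlinarith [mul_nonneg h h']
        · rw [abs_of_nonneg h, abs_of_nonpos h']; ring
        · rw [abs_of_nonpos h, abs_of_nonneg h']; ring
        · rw [abs_of_nonpos h, abs_of_nonpos h']; nlinarith [mul_nonneg_of_nonpos_of_nonpos h h']
      rcases mul_eq_zero.1 this with h | h
      · linarith
      · exact h
    · rw [mx] at hx
      exact nonneg_of_mul_nonneg_right hx hρ
    · have : 0 ≤ ρ * (sn k c * m.z - cs k c * m.x) := by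
        have : ρ * (sn k c * m.z - cs k c * m.x) =
            sn k c * (ρ * m.z) - cs k c * (ρ * m.x) := by ring
        rw [this, ← mx, ← mz]
        linarith
      exact nonneg_of_mul_nonneg_right this hρ

/-- A triangle can be erected on `[p, q]` so that its apex `w` is opposite to `e` and hence to
every `y` that is on the same side as `e`. For all these `y`, the segment `[w, y]` meets `[p, q]`
or one of the angles at `p` and `q` is reflex. -/
lemma exists_apex (p q e : Pt k) {a b : ℝ} (h1 : d p q ≤ a + b) (h2 : a ≤ d p q + b)
    (h3 : b ≤ d p q + a) (hs : k = .pos → a + b + d p q < 2 * Real.pi) :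
    ∃ w, d w p = a ∧ d w q = b ∧ ∀ y, (y = e ∨ ∃ x, InSeg x p y ∧ InSeg x e q ∧ x ≠ p) →
      (k = .pos → a + b + (d p y + d y q) < 2 * Real.pi) →
      Cross w y p q ∨ Refl w p q y ∨ Refl w q p y := by
  obtain ⟨w, T, e1, e2, hside, hwp, hwq⟩ := exists_triangle_opposite p q e h1 h2 h3 hs
  refine ⟨w, hwp, hwq, fun y hy hper => ?_⟩
  rcases (d_nonneg p q).eq_or_lt with h0 | h0
  · have hpq := eq_of_d_eq_zero h0.symm
    subst hpq
    right; left
    have ha : 0 ≤ a := by rw [← hwp]; exact d_nonneg _ _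
    obtain ⟨u, hu1, hu2⟩ := exists_extension p y ha (fun hk => by
      have := hper hk
      rw [d_comm y p] at this
      linarith)
    exact ⟨u, by rw [hu1, hwp], by rw [hu1, hwp], by rw [hu2, hu1]⟩
  · have hside' : (T.f w).y * (T.f y).y ≤ 0 := by
      rcases hy with rfl | ⟨x, hx1, hx2, hxp⟩
      · exact hside
      · obtain ⟨α, β, nα, nβ, x1, y1, z1⟩ := (T.seg _ _ _).2 hx1
        obtain ⟨γ, δ, nγ, nδ, x2, y2, z2⟩ := (T.seg _ _ _).2 hx2
        rcases nβ.eq_or_lt with hβ | hβ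
        · exfalso
          apply hxp
          apply T.f.injective
          refine eq_of_smul nα ?_ ?_ ?_
          · rw [x1, ← hβ]; ring
          · rw [y1, ← hβ]; ring
          · rw [z1, ← hβ]; ring
        · rw [e1] at y1
          rw [e2] at y2
          simp only [pole, polar] at y1 y2
          have hyy : β * (T.f y).y = γ * (T.f e).y := by linarith
          have : β * ((T.f w).y * (T.f y).y) ≤ 0 := by
            have := mul_nonpos_of_nonneg_of_nonpos nγ hside
            linear_combination this + (T.f w).y * hyy
          by_contra! hlt
          have := mul_pos hβ hlt
          linarith
    have hc : LtDiam k (d p q) := fun hk => by have := hs hk; linarith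
    have := cross_or_refl_normal (T.f w) (T.f y) h0 hc hside' (by
      intro hk
      have := hper hk
      rw [← e1, ← e2, T.d, T.d, T.d, T.d, hwp, hwq]
      linarith)
    rw [← e1, ← e2] at this
    rcases this with h | h | h
    · exact Or.inl (h.of_motion T)
    · exact Or.inr (Or.inl (h.of_motion T))
    · exact Or.inr (Or.inr (h.of_motion T))

/-- If the angle at `p` is reflex for `y`, it is reflex for every `e` such that `[p, y]` lies
between `[p, e]` and `[p, q]`. -/
lemma Refl.mono {w p q y e x : Pt k} (h : Refl w p q y) (hx : InSeg x p y) (hx' : InSeg x e q)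
    (hpy : LtDiam k (d p y))
    (hper : k = .pos → d w p + d w q + (d p e + d e q) < 2 * Real.pi) : Refl w p q e := by
  obtain ⟨u, hu1, hu2, hu3⟩ := h
  have hpq : d p q ≤ d w p + d w q := by
    have := d_triangle p w q
    rwa [d_comm p w] at this
  have heq : LtDiam k (d e q) := fun hk => by
    have h1 := d_triangle e p q
    rw [d_comm e p] at h1
    have := hper hk
    linarith
  have hxa := hx.d_add hpy
  have hxe := hx'.d_add heq
  have hux : d u x = d w p + d p x := by
    have t1 := d_triangle u x y
    have t2 := d_triangle u p x
    rw [hu1] at hu3 t2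
    linarith
  have hle : d w p + d p e ≤ d w q + d e q := by
    have t1 := d_triangle u q x
    have t2 := d_triangle p x e
    rw [d_comm q x] at t1
    rw [d_comm x e] at t2
    linarith
  obtain ⟨v, hv1, hv2⟩ := exists_extension p e (d_nonneg w p) (fun hk => by
    have := hper hk
    linarith)
  -- `u` and `v` prolong `[y, p]` and `[e, p]`; if `v` were farther from `q` than `u`, it would be
  -- farther from `x`, contrary to `d u x = d u p + d p x`
  by_cases hvq : d v q ≤ d u q
  · exact ⟨v, hv1, hvq.trans hu2, by rw [hv1, hv2]⟩
  · push Not at hvq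
    by_cases hxe' : x = e
    · subst hxe'
      exact ⟨u, hu1, hu2, by rw [hux, hu1]⟩
    · exfalso
      have hue : d e u ≤ d e v := by
        have := d_triangle u p e
        rw [d_comm e u, d_comm e v, hv2]
        linarith
      have := cevian_strictMono hx' heq hxe' hue (by rwa [d_comm q u, d_comm q v])
      rw [d_comm x u, d_comm x v, hux] at this
      have := d_triangle v p x
      linarith

/-- In the reflex case, `w` may be replaced by the prolongation of `[y, p]` without getting farther
from any point of the edge. -/
lemma Refl.prolong {w p q y : Pt k} (h : Refl w p q y) (hs : LtDiam k (d p q)) :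
    ∃ w', d w' p = d w p ∧ d w' y = d w p + d p y ∧ ∀ m, InSeg m p q → d w' m ≤ d w m := by
  obtain ⟨u, hu1, hu2, hu3⟩ := h
  exact ⟨u, hu1, by rw [hu3, hu1], fun m hm => seg_mono hm hs hu1.le hu2⟩

/-- The shortest path from `w` to `b` through a point `m₀` of `[p, q]` can be straightened without
making `w` more distant from any point of `[p, q]`. -/
lemma exists_straighten (w p q b : Pt k)
    (hper : k = .pos → d w p + d w q + (d p b + d b q) < 2 * Real.pi) :
    ∃ w' m₀, InSeg m₀ p q ∧ d w' b = d w m₀ + d m₀ b ∧ ∀ m, InSeg m p q → d w' m ≤ d w m := by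
  have t1 := d_triangle p w q
  have t2 := d_triangle w q p
  have t3 := d_triangle w p q
  have t4 := d_triangle p b q
  rw [d_comm p w] at t1
  rw [d_comm q p] at t2
  have hpq : LtDiam k (d p q) := fun hk => by have := hper hk; linarith
  obtain ⟨v, hv1, hv2, hv⟩ := exists_apex p q b (a := d w p) (b := d w q) t1 (by linarith)
    (by linarith) (fun hk => by have := hper hk; linarith)
  rcases hv b (Or.inl rfl) hper with ⟨m, hm1, hm2⟩ | h | h
  · have hvb : LtDiam k (d v b) := fun hk => by
      have := hper hk
      have := d_triangle v p b
      have := d_triangle v q b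
      rw [d_comm q b] at this
      linarith
    have hvm : ∀ n, InSeg n p q → d v n = d w n := fun n hn =>
      le_antisymm (seg_mono hn hpq hv1.le hv2.le) (seg_mono hn hpq hv1.ge hv2.ge)
    refine ⟨v, m, hm2, ?_, fun n hn => (hvm n hn).le⟩
    rw [← hm1.d_add hvb, hvm m hm2]
  · obtain ⟨u, hu1, hu2, hu3⟩ := h.prolong hpq
    refine ⟨u, p, InSeg.left _ _, by rw [hu2, hv1], fun n hn => (hu3 n hn).trans ?_⟩
    exact seg_mono hn hpq hv1.le hv2.le
  · obtain ⟨u, hu1, hu2, hu3⟩ := h.prolong (by rwa [d_comm])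
    refine ⟨u, q, InSeg.right _ _, by rw [hu2, hv2], fun n hn => (hu3 n hn.symm).trans ?_⟩
    exact seg_mono hn hpq hv1.le hv2.le

/-! ### Abstract polygons and their realizations -/

/-- A symmetric function `D` on the vertices `0, …, N` of a polygon with the triangle inequality,
admissible perimeter, and a comparison quadrilateral for any four vertices in cyclic order, with
sides not longer and diagonals not shorter than those prescribed by `D`. -/
structure IsPolyDist (k : SignType) (N : ℕ) (D : ℕ → ℕ → ℝ) : Prop where
  symm : ∀ i j, D i j = D j i
  tri : ∀ i j l, i ≤ N → j ≤ N → l ≤ N → D i l ≤ D i j + D j l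
  quad : ∀ i j l r, i < j → j < l → l < r → r ≤ N → ∃ p₀ p₁ p₂ p₃ : Pt k,
    d p₀ p₁ ≤ D i j ∧ d p₁ p₂ ≤ D j l ∧ d p₂ p₃ ≤ D l r ∧ d p₀ p₃ ≤ D i r ∧
      D i l ≤ d p₀ p₂ ∧ D j r ≤ d p₁ p₃
  per : k = .pos → ∑ i ∈ Finset.range N, D i (i + 1) + D 0 N < 2 * Real.pi

/-- The polygon `g 0, …, g N` in the model plane has the side lengths prescribed by `D`, its
diagonals are not shorter than prescribed, and it is convex: diagonals whose ends alternate meet.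
-/
structure Realizes (N : ℕ) (D : ℕ → ℕ → ℝ) (g : ℕ → Pt k) : Prop where
  side : ∀ i, i < N → d (g i) (g (i + 1)) = D i (i + 1)
  close : d (g 0) (g N) = D 0 N
  diag : ∀ i j, i < j → j ≤ N → D i j ≤ d (g i) (g j)
  conv : ∀ i j l r, i < j → j < l → l < r → r ≤ N →
    ∃ x, InSeg x (g i) (g l) ∧ InSeg x (g j) (g r)

namespace Realizes

variable {N : ℕ} {D : ℕ → ℕ → ℝ} {g : ℕ → Pt k}

lemma chain (h : Realizes N D g) {i j : ℕ} (hij : i ≤ j) (hj : j ≤ N) :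
    d (g i) (g j) ≤ ∑ l ∈ Finset.range j, D l (l + 1) - ∑ l ∈ Finset.range i, D l (l + 1) := by
  induction j, hij using Nat.le_induction with
  | base => simp
  | succ j hij ih =>
    rw [Finset.sum_range_succ, ← h.side j (by omega)]
    have := ih (by omega)
    have := d_triangle (g i) (g j) (g (j + 1))
    linarith

lemma small (h : Realizes N D g)
    (hper : k = .pos → ∑ i ∈ Finset.range N, D i (i + 1) + D 0 N < 2 * Real.pi) {i j : ℕ}
    (hi : i ≤ N) (hj : j ≤ N) : LtDiam k (d (g i) (g j)) := by
  wlog hij : i ≤ j generalizing i j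
  · rw [d_comm]; exact this hj hi (by omega)
  intro hk
  have h1 := h.chain hij hj
  have h2 := h.chain (Nat.zero_le i) hi
  have h3 := h.chain hj le_rfl
  have h4 := d_triangle (g i) (g 0) (g j)
  have h5 := d_triangle (g 0) (g N) (g j)
  have := hper hk
  rw [h.close] at h5
  rw [d_comm (g i) (g 0)] at h4
  rw [d_comm (g N) (g j)] at h5
  simp only [Finset.range_zero, Finset.sum_empty] at h2
  linarith

end Realizes

/-! ### Folding a vertex over a closing edge -/

/-- `F` is a distance function on the vertices `0, …, N + 1` that dominates `D`, agrees with the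
polygon `g` on `0, …, N`, and measures distances from the last vertex `w` within the union of the
polygon `g` and the triangle glued to it along its closing edge, that is, along shortest paths that
cross the edge `[g 0, g N]`. -/
structure Fold (N : ℕ) (D : ℕ → ℕ → ℝ) (g : ℕ → Pt k) (w : Pt k) (F : ℕ → ℕ → ℝ) : Prop where
  symm : ∀ i j, F i j = F j i
  planar : ∀ i j, i ≤ N → j ≤ N → F i j = d (g i) (g j)
  left : F 0 (N + 1) = D 0 (N + 1)
  right : F N (N + 1) = D N (N + 1)
  dom : ∀ i j, i < j → j ≤ N + 1 → D i j ≤ F i j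
  tri : ∀ i j l, i ≤ N + 1 → j ≤ N + 1 → l ≤ N + 1 → F i l ≤ F i j + F j l
  quad : ∀ i j l r, i < j → j < l → l < r → r ≤ N + 1 → ∃ p₀ p₁ p₂ p₃ : Pt k,
    d p₀ p₁ ≤ F i j ∧ d p₁ p₂ ≤ F j l ∧ d p₂ p₃ ≤ F l r ∧ d p₀ p₃ ≤ F i r ∧
      F i l ≤ d p₀ p₂ ∧ F j r ≤ d p₁ p₃
  le_path : ∀ i m, i ≤ N → InSeg m (g 0) (g N) → F i (N + 1) ≤ d w m + d m (g i)
  ge_of_le : ∀ u, (∀ m, InSeg m (g 0) (g N) → d u m ≤ d w m) → ∀ i, i ≤ N →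
    d u (g i) ≤ F i (N + 1)

variable {N : ℕ} {D : ℕ → ℕ → ℝ} {g : ℕ → Pt k} {w : Pt k} {F : ℕ → ℕ → ℝ}

lemma exists_fold (hD : IsPolyDist k (N + 1) D) (hg : Realizes N D g)
    (hw0 : d w (g 0) = D 0 (N + 1)) (hwN : d w (g N) = D N (N + 1)) :
    ∃ F, Fold N D g w F := by
  have hex : ∀ i, ∃ w' m₀, i ≤ N → InSeg m₀ (g 0) (g N) ∧ d w' (g i) = d w m₀ + d m₀ (g i) ∧
      ∀ m, InSeg m (g 0) (g N) → d w' m ≤ d w m := by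
    intro i
    by_cases hi : i ≤ N
    · obtain ⟨w', m₀, h⟩ := exists_straighten w (g 0) (g N) (g i) (by
        intro hk
        have h1 := hg.chain (Nat.zero_le i) hi
        have h2 := hg.chain hi le_rfl
        have := hD.per hk
        rw [Finset.sum_range_succ] at this
        simp only [Finset.range_zero, Finset.sum_empty] at h1
        linarith)
      exact ⟨w', m₀, fun _ => h⟩
    · exact ⟨w, w, fun h => absurd h hi⟩
  choose v n hvn using hex
  -- `E i` is the length of a shortest path from `w` to `g i` through the edge, crossing it at
  -- `n i`
  set E : ℕ → ℝ := fun i => d (v i) (g i) with hE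
  have Eeq : ∀ i, i ≤ N → E i = d w (n i) + d (n i) (g i) := fun i hi => (hvn i hi).2.1
  have Epath : ∀ i m, i ≤ N → InSeg m (g 0) (g N) → E i ≤ d w m + d m (g i) := by
    intro i m hi hm
    have h1 := (hvn i hi).2.2 m hm
    have h2 := d_triangle (v i) m (g i)
    show d (v i) (g i) ≤ _
    linarith
  have Ege : ∀ u, (∀ m, InSeg m (g 0) (g N) → d u m ≤ d w m) → ∀ i, i ≤ N →
      d u (g i) ≤ E i := by
    intro u hu i hi
    rw [Eeq i hi]
    have h1 := hu (n i) (hvn i hi).1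
    have h2 := d_triangle u (n i) (g i)
    linarith
  have Ew : ∀ i, i ≤ N → d w (g i) ≤ E i := Ege w (fun _ _ => le_rfl)
  have Etri : ∀ i j, i ≤ N → j ≤ N → E i ≤ E j + d (g j) (g i) := by
    intro i j hi hj
    have h1 := Epath i (n j) hi (hvn j hj).1
    have h2 := d_triangle (n j) (g j) (g i)
    have h3 := Eeq j hj
    linarith
  have E0 : E 0 = D 0 (N + 1) := by
    apply le_antisymm
    · have := Epath 0 (g 0) (Nat.zero_le _) (InSeg.left _ _)
      simpa [hw0] using this
    · rw [← hw0]; exact Ew 0 (Nat.zero_le _)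
  have EN : E N = D N (N + 1) := by
    apply le_antisymm
    · have := Epath N (g N) le_rfl (InSeg.right _ _)
      simpa [hwN] using this
    · rw [← hwN]; exact Ew N le_rfl
  have Edom : ∀ i, i ≤ N → D i (N + 1) ≤ E i := by
    intro i hi
    rcases Nat.eq_zero_or_pos i with rfl | h0
    · exact E0.ge
    rcases hi.eq_or_lt with rfl | hN
    · exact EN.ge
    obtain ⟨p₀, p₁, p₂, p₃, h01, h12, h23, h03, h02, h13⟩ :=
      hD.quad 0 i N (N + 1) h0 hN (Nat.lt_succ_self N) le_rfl
    rw [Eeq i hi]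
    have := cross_le (g₁ := g i) (g₃ := w) (hvn i hi).1 (p₀ := p₀) (p₁ := p₁) (p₂ := p₂) (p₃ := p₃)
      (by rw [hg.close]; exact h02) (h01.trans (hg.diag 0 i h0 hi))
      (by rw [d_comm p₂, d_comm (g N)]; exact h12.trans (hg.diag i N hN le_rfl))
      (by rw [d_comm (g 0), hw0]; exact h03) (by rw [d_comm (g N), hwN]; exact h23)
    rw [d_comm (g i), d_comm (n i) w] at this
    linarith
  refine ⟨fun i j => if i ≤ N then (if j ≤ N then d (g i) (g j) else E i) else
    (if j ≤ N then E j else 0), ?_, ?_, ?_, ?_, ?_, ?_, ?_, ?_, ?_⟩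
  · intro i j
    split_ifs
    · exact d_comm _ _
    · rfl
    · rfl
    · rfl
  · intro i j hi hj
    simp only [hi, hj, if_true]
  · simp [E0]
  · simp [EN]
  · intro i j hij hj
    have hi : i ≤ N := by omega
    simp only [hi, if_true]
    split_ifs with h
    · exact hg.diag i j hij h
    · have : j = N + 1 := by omega
      subst this
      exact Edom i hi
  · intro i j l hi hj hl
    have En : ∀ i, 0 ≤ E i := fun i => d_nonneg _ _
    by_cases a : i ≤ N <;> by_cases b : j ≤ N <;> by_cases c : l ≤ N <;>
      simp only [a, b, c, if_true, if_false]
    · exact d_triangle _ _ _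
    · have := Etri i j a b
      rw [d_comm (g i)]; linarith
    · have h1 := Ew i a
      have h2 := Ew l c
      have h3 := d_triangle (g i) w (g l)
      rw [d_comm (g i) w] at h3
      linarith
    · simp
    · have := Etri l j c b
      linarith
    · have := En j
      linarith
    · simp
    · simp
  · intro i j l r hij hjl hlr hr
    have hi : i ≤ N := by omega
    have hj : j ≤ N := by omega
    have hl : l ≤ N := by omega
    by_cases hrN : r ≤ N
    · exact ⟨g i, g j, g l, g r, by simp [hi, hj, hl, hrN]⟩
    · -- the straightened position of `w` for its opposite vertex `j` serves all four vertices
      refine ⟨g i, g j, g l, v j, ?_⟩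
      simp only [hi, hj, hl, hrN, if_true, if_false, le_refl, true_and]
      refine ⟨?_, ?_, (d_comm _ _).le⟩
      · rw [d_comm]; exact Ege (v j) (hvn j hj).2.2 l hl
      · rw [d_comm]; exact Ege (v j) (hvn j hj).2.2 i hi
  · intro i m hi hm
    simpa [hi] using Epath i m hi hm
  · intro u hu i hi
    simpa [hi] using Ege u hu i hi

lemma Fold.comp_isPolyDist (hF : Fold N D g w F) {σ : ℕ → ℕ} (hσ : StrictMono σ)
    (hσN : ∀ i, i ≤ N → σ i ≤ N + 1)
    (hper : k = .pos →
      ∑ i ∈ Finset.range N, F (σ i) (σ (i + 1)) + F (σ 0) (σ N) < 2 * Real.pi) :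
    IsPolyDist k N (fun i j => F (σ i) (σ j)) where
  symm _ _ := hF.symm _ _
  tri _ _ _ hi hj hl := hF.tri _ _ _ (hσN _ hi) (hσN _ hj) (hσN _ hl)
  quad _ _ _ _ hij hjl hlr hr := hF.quad _ _ _ _ (hσ hij) (hσ hjl) (hσ hlr) (hσN _ hr)
  per := hper

lemma Fold.side_eq (hF : Fold N D g w F) (hg : Realizes N D g) {i : ℕ} (hi : i ≤ N) :
    F i (i + 1) = D i (i + 1) := by
  rcases hi.eq_or_lt with rfl | h
  · exact hF.right
  · rw [hF.planar i (i + 1) hi h, hg.side i h]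

/-- If the glued polygon is reflex at vertex `0`, this vertex can be straightened: a realization of
the remaining vertices with side `F 1 (N + 1) = D 0 1 + D 0 (N + 1)` is subdivided at `0`. -/
lemma realize_of_refl_zero (hN : 1 ≤ N) (hD : IsPolyDist k (N + 1) D) (hg : Realizes N D g)
    (hw0 : d w (g 0) = D 0 (N + 1)) (hF : Fold N D g w F) (hR : Refl w (g 0) (g N) (g 1))
    (ih : ∀ D', IsPolyDist k N D' → ∃ g : ℕ → Pt k, Realizes N D' g) :
    ∃ g : ℕ → Pt k, Realizes (N + 1) D g := by
  have hgper : k = .pos → ∑ i ∈ Finset.range N, D i (i + 1) + D 0 N < 2 * Real.pi := fun hk => by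
    have h1 := hD.per hk
    have h2 := hD.tri 0 (N + 1) N (by omega) le_rfl (by omega)
    rw [hD.symm (N + 1) N] at h2
    rw [Finset.sum_range_succ] at h1
    linarith
  obtain ⟨u, hu1, hu2, hu3⟩ := hR.prolong (hg.small hgper (Nat.zero_le _) le_rfl)
  have hF1 : F 1 (N + 1) = D 0 1 + D 0 (N + 1) := by
    have h1 := hF.ge_of_le u hu3 1 hN
    have h2 := hF.tri 1 0 (N + 1) (by omega) (by omega) le_rfl
    rw [hF.left, hF.symm 1 0, hF.planar 0 1 (by omega) hN, hg.side 0 (by omega)] at h2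
    rw [hu2, hw0, hg.side 0 (by omega)] at h1
    linarith
  have hD' : IsPolyDist k N (fun i j => F (i + 1) (j + 1)) := by
    refine hF.comp_isPolyDist (σ := fun i => i + 1) (fun _ _ h => Nat.succ_lt_succ h)
      (fun i hi => by omega) (fun hk => ?_)
    have h1 := hD.per hk
    rw [Finset.sum_range_succ'] at h1
    have h2 : ∑ i ∈ Finset.range N, F (i + 1) (i + 1 + 1) =
        ∑ i ∈ Finset.range N, D (i + 1) (i + 1 + 1) :=
      Finset.sum_congr rfl fun i hi => hF.side_eq hg (by have := Finset.mem_range.1 hi; omega)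
    simp only [zero_add] at h1 ⊢
    rw [h2, hF1]
    linarith
  obtain ⟨g', hg'⟩ := ih _ hD'
  have hsm : ∀ {i j : ℕ}, i ≤ N → j ≤ N → LtDiam k (d (g' i) (g' j)) :=
    fun hi hj => hg'.small hD'.per hi hj
  have hclose : d (g' 0) (g' N) = D 0 1 + D 0 (N + 1) := by rw [hg'.close, ← hF1]
  have n1 : 0 ≤ D 0 1 := by rw [← hg.side 0 (by omega)]; exact d_nonneg _ _
  have n2 : 0 ≤ D 0 (N + 1) := by rw [← hw0]; exact d_nonneg _ _
  obtain ⟨z, hz, hz1, hz2⟩ := exists_between n1 n2 hclose (hsm (by omega) le_rfl)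
  -- `u` prolongs `[g 1, g 0]`, so `[g 1, u]` and `[g' 0, g' N]` are equal and equally divided
  have hdu : d (g 1) u = d (g' 0) (g' N) := by
    rw [d_comm, hu2, hw0, hg.side 0 (by omega), hclose]; ring
  have hseg : InSeg (g 0) (g 1) u := by
    apply inSeg_of_d_add
    · rw [hdu]; exact hsm (by omega) le_rfl
    · rw [d_comm (g 1) (g 0), d_comm (g 0) u, d_comm (g 1) u, hu2, hu1]; ring
  have hge : ∀ i j, i ≤ j → j < N → d (g (i + 1)) (g (j + 1)) ≤ d (g' i) (g' j) := by
    intro i j hij hj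
    rcases hij.eq_or_lt with rfl | h
    · simp
    · rw [← hF.planar _ _ (by omega) (by omega)]
      exact hg'.diag i j h hj.le
  refine ⟨fun i => Nat.casesOn i z g', ?_, ?_, ?_, ?_⟩
  · rintro (_ | i) hi
    · show d z (g' 0) = _
      rw [d_comm, hz1]
    · show d (g' i) (g' (i + 1)) = _
      rw [hg'.side i (by omega)]
      exact hF.side_eq hg (by omega)
  · exact hz2
  · rintro (_ | i) (_ | j) hij hj
    · omega
    · show _ ≤ d z (g' j)
      rcases (Nat.lt_succ_iff.1 hj).eq_or_lt with rfl | hjN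
      · exact hz2.ge
      · refine (hg.diag 0 (j + 1) (by omega) (by omega)).trans ?_
        refine cevian_mono hseg hz (by rw [hdu]; exact hsm (by omega) le_rfl) ?_ ?_ ?_ ?_
          (hsm (by omega) le_rfl)
        · rw [hz1, d_comm, hg.side 0 (by omega)]
        · rw [hz2, d_comm, hu1, hw0]
        · exact hge 0 j (by omega) hjN
        · refine (hF.ge_of_le u hu3 (j + 1) hjN).trans ?_
          rw [d_comm]
          exact hg'.diag j N hjN le_rfl
    · omega
    · show _ ≤ d (g' i) (g' j)
      exact (hF.dom _ _ hij hj).trans (hg'.diag i j (by omega) (by omega))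
  · rintro (_ | i) (_ | j) (_ | l) (_ | r) hij hjl hlr hr <;> try omega
    · show ∃ x, InSeg x z (g' l) ∧ InSeg x (g' j) (g' r)
      have hx : ∃ x, InSeg x (g' j) (g' r) ∧ InSeg x (g' l) (g' 0) := by
        rcases Nat.eq_zero_or_pos j with rfl | h
        · exact ⟨_, InSeg.left _ _, InSeg.right _ _⟩
        · obtain ⟨x, h1, h2⟩ := hg'.conv 0 j l r h (by omega) (by omega) (by omega)
          exact ⟨x, h2, h1.symm⟩
      have hy : ∃ y, InSeg y (g' j) (g' r) ∧ InSeg y (g' l) (g' N) := by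
        rcases (by omega : r ≤ N).eq_or_lt with rfl | h
        · exact ⟨_, InSeg.right _ _, InSeg.right _ _⟩
        · exact hg'.conv j l r N (by omega) (by omega) h le_rfl
      obtain ⟨x, hx1, hx2⟩ := hx
      obtain ⟨y, hy1, hy2⟩ := hy
      obtain ⟨t, ht1, ht2⟩ := pasch hx1 hy1 hx2 hy2 hz (hsm (by omega) (by omega))
      exact ⟨t, ht2.symm, ht1⟩
    · exact hg'.conv i j l r (by omega) (by omega) (by omega) (by omega)

/-- If the glued polygon is reflex at vertex `M + 1`, the other end of the gluing edge, this vertex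
can be straightened in the same way. -/
lemma realize_of_refl_last {M : ℕ} {g : ℕ → Pt k} (hM : 1 ≤ M) (hD : IsPolyDist k (M + 2) D)
    (hg : Realizes (M + 1) D g) (hwN : d w (g (M + 1)) = D (M + 1) (M + 2))
    (hF : Fold (M + 1) D g w F) (hR : Refl w (g (M + 1)) (g 0) (g M))
    (ih : ∀ D', IsPolyDist k (M + 1) D' → ∃ g : ℕ → Pt k, Realizes (M + 1) D' g) :
    ∃ g : ℕ → Pt k, Realizes (M + 2) D g := by
  have hgper : k = .pos →
      ∑ i ∈ Finset.range (M + 1), D i (i + 1) + D 0 (M + 1) < 2 * Real.pi := fun hk => by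
    have h1 := hD.per hk
    have h2 := hD.tri 0 (M + 2) (M + 1) (by omega) le_rfl (by omega)
    rw [hD.symm (M + 2) (M + 1)] at h2
    rw [Finset.sum_range_succ] at h1
    linarith
  obtain ⟨u, hu1, hu2, hu3⟩ := hR.prolong (hg.small hgper le_rfl (Nat.zero_le _))
  replace hu3 : ∀ m, InSeg m (g 0) (g (M + 1)) → d u m ≤ d w m := fun m hm => hu3 m hm.symm
  have hgM : d (g (M + 1)) (g M) = D M (M + 1) := by rw [d_comm, hg.side M (by omega)]
  have hF1 : F M (M + 2) = D M (M + 1) + D (M + 1) (M + 2) := by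
    have h1 := hF.ge_of_le u hu3 M (by omega)
    have h2 := hF.tri M (M + 1) (M + 2) (by omega) (by omega) le_rfl
    rw [hF.right, hF.planar M (M + 1) (by omega) le_rfl, hg.side M (by omega)] at h2
    rw [hu2, hwN, hgM] at h1
    linarith
  set σ : ℕ → ℕ := fun i => if i ≤ M then i else i + 1 with hσ
  have σle : ∀ i, i ≤ M → σ i = i := fun i hi => by simp [hσ, hi]
  have σM : σ (M + 1) = M + 2 := by simp [hσ]
  have hD' : IsPolyDist k (M + 1) (fun i j => F (σ i) (σ j)) := by
    refine hF.comp_isPolyDist (σ := σ) ?_ ?_ (fun hk => ?_)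
    · intro i j hij
      simp only [hσ]
      split_ifs <;> omega
    · intro i hi
      simp only [hσ]
      split_ifs <;> omega
    · have h1 := hD.per hk
      rw [Finset.sum_range_succ, Finset.sum_range_succ] at h1
      have h2 : ∑ i ∈ Finset.range M, F (σ i) (σ (i + 1)) =
          ∑ i ∈ Finset.range M, D i (i + 1) := by
        refine Finset.sum_congr rfl fun i hi => ?_
        have := Finset.mem_range.1 hi
        rw [σle i (by omega), σle (i + 1) (by omega)]
        exact hF.side_eq hg (by omega)
      have h3 := hF.left
      rw [Finset.sum_range_succ, h2, σle M le_rfl, σle 0 (Nat.zero_le _), σM, h3, hF1]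
      linarith
  obtain ⟨g', hg'⟩ := ih _ hD'
  have hsm : ∀ {i j : ℕ}, i ≤ M + 1 → j ≤ M + 1 → LtDiam k (d (g' i) (g' j)) :=
    fun hi hj => hg'.small hD'.per hi hj
  have hside : d (g' M) (g' (M + 1)) = D M (M + 1) + D (M + 1) (M + 2) := by
    rw [hg'.side M (by omega), σle M le_rfl, σM, hF1]
  have n1 : 0 ≤ D M (M + 1) := by rw [← hgM]; exact d_nonneg _ _
  have n2 : 0 ≤ D (M + 1) (M + 2) := by rw [← hwN]; exact d_nonneg _ _
  obtain ⟨z, hz, hz1, hz2⟩ := exists_between n1 n2 hside (hsm (by omega) le_rfl)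
  have hdu : d (g M) u = d (g' M) (g' (M + 1)) := by
    rw [d_comm, hu2, hwN, hgM, hside]; ring
  have hseg : InSeg (g (M + 1)) (g M) u := by
    apply inSeg_of_d_add
    · rw [hdu]; exact hsm (by omega) le_rfl
    · rw [d_comm (g M) (g (M + 1)), d_comm (g (M + 1)) u, d_comm (g M) u, hu2, hu1]; ring
  have hge : ∀ i j, i ≤ j → j ≤ M → d (g i) (g j) ≤ d (g' i) (g' j) := by
    intro i j hij hj
    rcases hij.eq_or_lt with rfl | h
    · simp
    · rw [← hF.planar _ _ (by omega) (by omega)]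
      have := hg'.diag i j h (by omega)
      rwa [σle i (by omega), σle j hj] at this
  have hge' : ∀ i, i ≤ M → F i (M + 2) ≤ d (g' i) (g' (M + 1)) := by
    intro i hi
    have := hg'.diag i (M + 1) (by omega) le_rfl
    rwa [σle i hi, σM] at this
  set h : ℕ → Pt k := fun i => if i ≤ M then g' i else if i = M + 1 then z else g' (M + 1)
    with hh
  have hle : ∀ i, i ≤ M → h i = g' i := fun i hi => by simp [hh, hi]
  have hM1 : h (M + 1) = z := by simp [hh]
  have hM2 : h (M + 2) = g' (M + 1) := by simp [hh]
  refine ⟨h, ?_, ?_, ?_, ?_⟩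
  · intro i hi
    rcases (by omega : i < M ∨ i = M ∨ i = M + 1) with h1 | rfl | rfl
    · rw [hle i (by omega), hle (i + 1) (by omega), hg'.side i (by omega), σle i (by omega),
        σle (i + 1) (by omega)]
      exact hF.side_eq hg (by omega)
    · rw [hle i le_rfl, hM1, hz1]
    · rw [hM1, hM2, hz2]
  · rw [hle 0 (Nat.zero_le _), hM2, hg'.close, σle 0 (Nat.zero_le _), σM]
    exact hF.left
  · intro i j hij hj
    rcases (by omega : j ≤ M ∨ j = M + 1 ∨ j = M + 2) with h1 | rfl | rfl
    · rw [hle i (by omega), hle j h1]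
      exact (hg.diag i j hij (by omega)).trans (hge i j hij.le h1)
    · rw [hle i (by omega), hM1, d_comm]
      refine (hg.diag i (M + 1) hij le_rfl).trans ?_
      rw [d_comm]
      refine cevian_mono hseg hz (by rw [hdu]; exact hsm (by omega) le_rfl) ?_ ?_ ?_ ?_
        (hsm (by omega) le_rfl)
      · rw [hz1, d_comm, hgM]
      · rw [hz2, d_comm, hu1, hwN]
      · rw [d_comm, d_comm (g' M)]
        exact hge i M (by omega) le_rfl
      · refine (hF.ge_of_le u hu3 i (by omega)).trans ?_
        rw [d_comm (g' (M + 1))]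
        exact hge' i (by omega)
    · rcases (by omega : i ≤ M ∨ i = M + 1) with h2 | rfl
      · rw [hle i h2, hM2]
        exact (hF.dom i (M + 2) hij le_rfl).trans (hge' i h2)
      · rw [hM1, hM2, hz2]
  · intro i j l r hij hjl hlr hr
    rcases (by omega : r ≤ M ∨ r = M + 1 ∨ r = M + 2) with h1 | rfl | rfl
    · rw [hle i (by omega), hle j (by omega), hle l (by omega), hle r (by omega)]
      exact hg'.conv i j l r hij hjl hlr (by omega)
    · rw [hle i (by omega), hle j (by omega), hle l (by omega), hM1]
      have hx : ∃ x, InSeg x (g' i) (g' l) ∧ InSeg x (g' j) (g' M) := by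
        rcases (by omega : l ≤ M).eq_or_lt with rfl | h1
        · exact ⟨_, InSeg.right _ _, InSeg.right _ _⟩
        · exact hg'.conv i j l M hij hjl h1 (by omega)
      obtain ⟨x, hx1, hx2⟩ := hx
      obtain ⟨y, hy1, hy2⟩ := hg'.conv i j l (M + 1) hij hjl (by omega) le_rfl
      exact pasch hx1 hy1 hx2 hy2 hz (hsm (by omega) (by omega))
    · rw [hle i (by omega), hle j (by omega), hM2]
      rcases (by omega : l ≤ M ∨ l = M + 1) with h1 | rfl
      · rw [hle l h1]
        exact hg'.conv i j l (M + 1) hij hjl (by omega) le_rfl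
      · rw [hM1]
        have hx : ∃ x, InSeg x (g' j) (g' (M + 1)) ∧ InSeg x (g' i) (g' M) := by
          rcases (by omega : j ≤ M).eq_or_lt with rfl | h1
          · exact ⟨_, InSeg.left _ _, InSeg.right _ _⟩
          · obtain ⟨x, h2, h3⟩ := hg'.conv i j M (M + 1) hij h1 (by omega) le_rfl
            exact ⟨x, h3, h2⟩
        obtain ⟨x, hx1, hx2⟩ := hx
        obtain ⟨t, ht1, ht2⟩ := pasch hx1 (InSeg.right (g' j) (g' (M + 1))) hx2
          (InSeg.right (g' i) (g' (M + 1))) hz (hsm (by omega) le_rfl)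
        exact ⟨t, ht2, ht1⟩

/-- If every segment from `w` to a vertex crosses the gluing edge, the glued polygon is convex. -/
lemma realize_of_cross (hD : IsPolyDist k (N + 1) D) (hg : Realizes N D g)
    (hw0 : d w (g 0) = D 0 (N + 1)) (hwN : d w (g N) = D N (N + 1)) (hF : Fold N D g w F)
    (hX : ∀ i, i ≤ N → Cross w (g i) (g 0) (g N)) :
    ∃ g : ℕ → Pt k, Realizes (N + 1) D g := by
  have hgper : k = .pos → ∑ i ∈ Finset.range N, D i (i + 1) + D 0 N < 2 * Real.pi := fun hk => by
    have h1 := hD.per hk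
    have h2 := hD.tri 0 (N + 1) N (by omega) le_rfl (by omega)
    rw [hD.symm (N + 1) N] at h2
    rw [Finset.sum_range_succ] at h1
    linarith
  set h : ℕ → Pt k := fun i => if i ≤ N then g i else w with hh
  have hle : ∀ i, i ≤ N → h i = g i := fun i hi => by simp [hh, hi]
  have hN1 : h (N + 1) = w := by simp [hh]
  refine ⟨h, ?_, ?_, ?_, ?_⟩
  · intro i hi
    rcases (by omega : i < N ∨ i = N) with h1 | rfl
    · rw [hle i (by omega), hle (i + 1) (by omega), hg.side i h1]
    · rw [hle i le_rfl, hN1, d_comm, hwN]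
  · rw [hle 0 (Nat.zero_le _), hN1, d_comm, hw0]
  · intro i j hij hj
    rcases (by omega : j ≤ N ∨ j = N + 1) with h1 | rfl
    · rw [hle i (by omega), hle j h1]
      exact hg.diag i j hij h1
    · have hi : i ≤ N := by omega
      rw [hle i hi, hN1, d_comm]
      obtain ⟨m, hm1, hm2⟩ := hX i hi
      have hs : LtDiam k (d w (g i)) := fun hk => by
        have h1 := hg.chain (Nat.zero_le i) hi
        have h2 := hg.chain hi le_rfl
        have h3 := hD.per hk
        have h4 := d_triangle w (g 0) (g i)
        have h5 := d_triangle w (g N) (g i)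
        rw [Finset.sum_range_succ] at h3
        rw [d_comm (g N) (g i)] at h5
        simp only [Finset.range_zero, Finset.sum_empty] at h1
        linarith
      rw [← hm1.d_add hs]
      exact (hF.dom i (N + 1) hij le_rfl).trans (hF.le_path i m hi hm2)
  · intro i j l r hij hjl hlr hr
    rcases (by omega : r ≤ N ∨ r = N + 1) with h1 | rfl
    · rw [hle i (by omega), hle j (by omega), hle l (by omega), hle r (by omega)]
      exact hg.conv i j l r hij hjl hlr h1
    · rw [hle i (by omega), hle j (by omega), hle l (by omega), hN1]
      have hx : ∃ x, InSeg x (g i) (g l) ∧ InSeg x (g j) (g 0) := by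
        rcases Nat.eq_zero_or_pos i with rfl | h1
        · exact ⟨_, InSeg.left _ _, InSeg.right _ _⟩
        · obtain ⟨x, h2, h3⟩ := hg.conv 0 i j l h1 hij hjl (by omega)
          exact ⟨x, h3, h2.symm⟩
      have hy : ∃ y, InSeg y (g i) (g l) ∧ InSeg y (g j) (g N) := by
        rcases (by omega : l ≤ N).eq_or_lt with rfl | h1
        · exact ⟨_, InSeg.right _ _, InSeg.right _ _⟩
        · exact hg.conv i j l N hij hjl h1 le_rfl
      obtain ⟨x, hx1, hx2⟩ := hx
      obtain ⟨y, hy1, hy2⟩ := hy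
      obtain ⟨m, hm1, hm2⟩ := hX j (by omega)
      obtain ⟨t, ht1, ht2⟩ := pasch hx1 hy1 hx2 hy2 hm2 (hg.small hgper (by omega) (by omega))
      exact ⟨t, ht1, hm1.symm.trans ht2⟩

/-- The comparison theorem for abstract polygons. -/
theorem exists_realizes : ∀ (M : ℕ) (D : ℕ → ℕ → ℝ), IsPolyDist k (M + 2) D →
    ∃ g : ℕ → Pt k, Realizes (M + 2) D g
  | 0, D, hD => by
    have t1 := hD.tri 0 2 1 (by omega) (by omega) (by omega)
    have t2 := hD.tri 0 1 2 (by omega) (by omega) (by omega)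
    have t3 := hD.tri 1 0 2 (by omega) (by omega) (by omega)
    rw [hD.symm 2 1] at t1
    rw [hD.symm 1 0] at t3
    have hper : k = .pos → D 0 1 + D 1 2 + D 0 2 < 2 * Real.pi := fun hk => by
      have := hD.per hk
      simp [Finset.sum_range_succ] at this
      linarith
    obtain ⟨q, hq⟩ := exists_triangle (pole k) (pole k) (a := D 0 1) (b := D 0 1)
      (by rw [d_self]; linarith) (by rw [d_self]; linarith) (by rw [d_self]; linarith)
      (fun hk => by rw [d_self]; have := hper hk; linarith)
    have hpq : d (pole k) q = D 0 1 := by rw [d_comm, hq.1]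
    obtain ⟨w, hw1, hw2⟩ := exists_triangle (pole k) q (a := D 0 2) (b := D 1 2)
      (by rw [hpq]; linarith) (by rw [hpq]; linarith) (by rw [hpq]; linarith)
      (fun hk => by rw [hpq]; have := hper hk; linarith)
    have hw1' : d (pole k) w = D 0 2 := by rw [d_comm, hw1]
    have hw2' : d q w = D 1 2 := by rw [d_comm, hw2]
    refine ⟨fun i => if i = 0 then pole k else if i = 1 then q else w, ?_, ?_, ?_, ?_⟩
    · intro i hi
      interval_cases i
      · simpa using hpq
      · simpa using hw2'
    · simpa using hw1'
    · intro i j hij hj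
      rcases (by omega : i = 0 ∧ j = 1 ∨ i = 0 ∧ j = 2 ∨ i = 1 ∧ j = 2) with
        ⟨rfl, rfl⟩ | ⟨rfl, rfl⟩ | ⟨rfl, rfl⟩
      · simpa using hpq.ge
      · simpa using hw1'.ge
      · simpa using hw2'.ge
    · intro i j l r _ _ _ _
      omega
  | M + 1, D, hD => by
    have ih := exists_realizes M
    have t1 := hD.tri 0 (M + 3) (M + 2) (by omega) le_rfl (by omega)
    have t2 := hD.tri 0 (M + 2) (M + 3) (by omega) (by omega) le_rfl
    have t3 := hD.tri (M + 2) 0 (M + 3) (by omega) (by omega) le_rfl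
    rw [hD.symm (M + 3) (M + 2)] at t1
    rw [hD.symm (M + 2) 0] at t3
    have hgper : k = .pos →
        ∑ i ∈ Finset.range (M + 2), D i (i + 1) + D 0 (M + 2) < 2 * Real.pi := fun hk => by
      have h1 := hD.per hk
      rw [Finset.sum_range_succ] at h1
      linarith
    obtain ⟨g, hg⟩ := ih D
      { symm := hD.symm
        tri := fun i j l hi hj hl => hD.tri i j l (by omega) (by omega) (by omega)
        quad := fun i j l r hij hjl hlr hr => hD.quad i j l r hij hjl hlr (by omega)
        per := hgper }
    have hpq := hg.close
    have hper : ∀ i, i ≤ M + 2 → k = .pos → D 0 (M + 3) + D (M + 2) (M + 3) +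
        (d (g 0) (g i) + d (g i) (g (M + 2))) < 2 * Real.pi := by
      intro i hi hk
      have h1 := hg.chain (Nat.zero_le i) hi
      have h2 := hg.chain hi le_rfl
      have h3 := hD.per hk
      rw [Finset.sum_range_succ] at h3
      simp only [Finset.range_zero, Finset.sum_empty] at h1
      linarith
    obtain ⟨w, hw0, hwN, hw⟩ := exists_apex (g 0) (g (M + 2)) (g 1) (a := D 0 (M + 3))
      (b := D (M + 2) (M + 3)) (by linarith) (by linarith) (by linarith) (fun hk => by
        have := hper 0 (Nat.zero_le _) hk
        rw [d_self] at this
        linarith)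
    obtain ⟨F, hF⟩ := exists_fold hD hg hw0 hwN
    by_cases hR0 : Refl w (g 0) (g (M + 2)) (g 1)
    · exact realize_of_refl_zero (by omega) hD hg hw0 hF hR0 ih
    by_cases hRN : Refl w (g (M + 2)) (g 0) (g (M + 1))
    · exact realize_of_refl_last (by omega) hD hg hwN hF hRN ih
    refine realize_of_cross hD hg hw0 hwN hF fun i hi => ?_
    rcases Nat.eq_zero_or_pos i with rfl | h0
    · exact ⟨_, InSeg.right _ _, InSeg.left _ _⟩
    rcases hi.eq_or_lt with rfl | hiN
    · exact ⟨_, InSeg.right _ _, InSeg.right _ _⟩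
    have hper1 : k = .pos → d w (g 0) + d w (g (M + 2)) +
        (d (g 0) (g 1) + d (g 1) (g (M + 2))) < 2 * Real.pi := by
      rw [hw0, hwN]; exact hper 1 (by omega)
    have hperM : k = .pos → d w (g (M + 2)) + d w (g 0) +
        (d (g (M + 2)) (g (M + 1)) + d (g (M + 1)) (g 0)) < 2 * Real.pi := fun hk => by
      rw [hw0, hwN, d_comm (g (M + 2)), d_comm (g (M + 1)) (g 0)]
      have := hper (M + 1) (by omega) hk
      linarith
    -- a reflex angle at an end of the edge for some vertex is reflex for the adjacent vertex
    have hnR0 : ¬ Refl w (g 0) (g (M + 2)) (g i) := by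
      intro hR
      apply hR0
      rcases (by omega : i = 1 ∨ 1 < i) with rfl | h1
      · exact hR
      · obtain ⟨x, hx1, hx2⟩ := hg.conv 0 1 i (M + 2) (by omega) h1 hiN le_rfl
        exact hR.mono hx1 hx2 (hg.small hgper (by omega) (by omega)) hper1
    have hnRN : ¬ Refl w (g (M + 2)) (g 0) (g i) := by
      intro hR
      apply hRN
      rcases (by omega : i = M + 1 ∨ i < M + 1) with rfl | h1
      · exact hR
      · obtain ⟨x, hx1, hx2⟩ := hg.conv 0 i (M + 1) (M + 2) (by omega) h1 (by omega) le_rfl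
        exact hR.mono hx2.symm hx1.symm (hg.small hgper le_rfl (by omega)) hperM
    have hy : g i = g 1 ∨ ∃ x, InSeg x (g 0) (g i) ∧ InSeg x (g 1) (g (M + 2)) ∧ x ≠ g 0 := by
      rcases (by omega : i = 1 ∨ 1 < i) with rfl | h1
      · exact Or.inl rfl
      · obtain ⟨x, hx1, hx2⟩ := hg.conv 0 1 i (M + 2) (by omega) h1 hiN le_rfl
        refine Or.inr ⟨x, hx1, hx2, ?_⟩
        rintro rfl
        -- if `g 0` lies on `[g 1, g (M + 2)]`, the angle at `g 0` is reflex for `g 1`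
        apply hR0
        exact Refl.mono (y := g 0) ⟨w, rfl, le_rfl, by simp⟩ (InSeg.left _ _) hx2
          (hg.small hgper (by omega) (by omega)) hper1
    rcases hw (g i) hy (hper i hi) with h | h | h
    · exact h
    · exact absurd h hnR0
    · exact absurd h hnRN

/-! ### The model planes as quadrics -/

/-- The model plane of curvature `κ` is, up to a scaling of the distance by `c = √|κ|` (or `1` for
`κ = 0`), the quadric of the corresponding sign. -/
lemma exists_chart (κ : ℝ) : ∃ (k : SignType) (c : ℝ) (φ : (modelPlane κ).carrier → Pt k), 0 < c ∧
    Function.Surjective φ ∧ (∀ u v, d (φ u) (φ v) = c * (modelPlane κ).d u v) ∧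
    ∀ s : ℝ, ENNReal.ofReal s < 2 * modelDiam κ ↔ (k = .pos → c * s < 2 * Real.pi) := by
  rcases lt_trichotomy κ 0 with h | h | h
  · have hP : modelPlane κ = ⟨UpperHalfPlane, fun x y => dist x y / Real.sqrt (-κ)⟩ := by
      unfold modelPlane
      rw [if_neg (not_lt.2 h.le), if_pos h]
    have hr : 0 < Real.sqrt (-κ) := Real.sqrt_pos.2 (by linarith)
    have hdiam : modelDiam κ = ⊤ := by
      unfold modelDiam
      rw [if_neg (not_lt.2 h.le)]
    rw [hP, hdiam]
    refine ⟨.neg, Real.sqrt (-κ), fun z => ⟨z.re / z.im, (z.re ^ 2 + z.im ^ 2 - 1) / (2 * z.im),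
      (z.re ^ 2 + z.im ^ 2 + 1) / (2 * z.im), ?_, ?_⟩, hr, ?_, ?_, ?_⟩
    · have := z.im_pos
      simp
      field_simp
      ring
    · intro _
      have := z.im_pos
      positivity
    · intro p
      have hp := p.eq
      have hpos := p.pos (by decide)
      simp at hp
      have hlt : 0 < p.z - p.y := by
        have : |p.y| < p.z := abs_lt_of_sq_lt_sq (by nlinarith [sq_nonneg p.x]) hpos.le
        linarith [le_abs_self p.y]
      refine ⟨⟨⟨p.x / (p.z - p.y), 1 / (p.z - p.y)⟩, by simpa using hlt⟩, ?_⟩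
      have hre : (⟨⟨p.x / (p.z - p.y), 1 / (p.z - p.y)⟩, by simpa using hlt⟩ : UpperHalfPlane).re =
        p.x / (p.z - p.y) := rfl
      have him : (⟨⟨p.x / (p.z - p.y), 1 / (p.z - p.y)⟩, by simpa using hlt⟩ : UpperHalfPlane).im =
        1 / (p.z - p.y) := rfl
      ext
      · simp only [hre, him]; field_simp
      · simp only [hre, him]; field_simp; linear_combination -hp
      · simp only [hre, him]; field_simp; linear_combination -hp
    · intro z w
      have e : Real.sqrt (-κ) * (dist z w / Real.sqrt (-κ)) = dist z w := by field_simp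
      simp only
      rw [e]
      refine d_eq_of_chord dist_nonneg (fun h => absurd h (by decide)) ?_
      have hz := z.im_pos
      have hw := w.im_pos
      rw [chord_neg_sign, UpperHalfPlane.cosh_dist, Complex.dist_eq, Complex.sq_norm,
        Complex.normSq_apply]
      simp [phi]
      field_simp
      ring
    · intro s
      simp
  · have hP : modelPlane κ = ⟨EuclideanSpace ℝ (Fin 2), fun x y => dist x y⟩ := by
      unfold modelPlane
      rw [if_neg (by linarith), if_neg (by linarith)]
    have hdiam : modelDiam κ = ⊤ := by
      unfold modelDiam
      rw [if_neg (by linarith)]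
    rw [hP, hdiam]
    refine ⟨.zero, 1, fun u => ⟨u 0, u 1, 1, by simp, fun _ => one_pos⟩, one_pos, ?_, ?_, ?_⟩
    · intro p
      refine ⟨!₂[p.x, p.y], ?_⟩
      ext
      · simp
      · simp
      · simp [p.z_eq_one]
    · intro (u : EuclideanSpace ℝ (Fin 2)) (v : EuclideanSpace ℝ (Fin 2))
      change d _ _ = 1 * dist u v
      rw [one_mul]
      refine d_eq_of_chord dist_nonneg (fun h => absurd h (by decide)) ?_
      rw [chord_zero_sign, EuclideanSpace.dist_eq, Real.sq_sqrt (by positivity)]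
      simp [phi, Fin.sum_univ_two, Real.dist_eq, sq_abs]
    · intro s
      simp
  · have hP : modelPlane κ = ⟨Metric.sphere (0 : EuclideanSpace ℝ (Fin 3)) 1, fun x y =>
        InnerProductGeometry.angle (x : EuclideanSpace ℝ (Fin 3)) (y : EuclideanSpace ℝ (Fin 3)) /
          Real.sqrt κ⟩ := by
      unfold modelPlane
      rw [if_pos h]
    have hr : 0 < Real.sqrt κ := Real.sqrt_pos.2 h
    have hdiam : modelDiam κ = ENNReal.ofReal (Real.pi / Real.sqrt κ) := by
      unfold modelDiam
      rw [if_pos h]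
    rw [hP, hdiam]
    have hnorm : ∀ u : Metric.sphere (0 : EuclideanSpace ℝ (Fin 3)) 1,
        u.1 0 ^ 2 + u.1 1 ^ 2 + u.1 2 ^ 2 = 1 := by
      intro u
      have h1 : ‖u.1‖ = 1 := by simp
      have h2 := EuclideanSpace.real_norm_sq_eq u.1
      rw [h1, Fin.sum_univ_three] at h2
      linarith
    refine ⟨.pos, Real.sqrt κ, fun u => ⟨u.1 0, u.1 1, u.1 2, ?_, fun h => absurd rfl h⟩, hr,
      ?_, ?_, ?_⟩
    · have := hnorm u
      simpa using this
    · intro p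
      have hp := p.eq
      simp at hp
      refine ⟨⟨!₂[p.x, p.y, p.z], ?_⟩, ?_⟩
      · rw [mem_sphere_zero_iff_norm, EuclideanSpace.norm_eq, Fin.sum_univ_three]
        simp [hp]
      · ext <;> simp
    · intro u v
      have e : Real.sqrt κ * (InnerProductGeometry.angle u.1 v.1 / Real.sqrt κ) =
        InnerProductGeometry.angle u.1 v.1 := by field_simp
      simp only
      rw [e]
      refine d_eq_of_chord (InnerProductGeometry.angle_nonneg _ _)
        (fun _ => InnerProductGeometry.angle_le_pi _ _) ?_
      have h1 : ‖u.1‖ = 1 := by simp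
      have h2 : ‖v.1‖ = 1 := by simp
      have h3 := hnorm u
      have h4 := hnorm v
      rw [chord_pos_sign, InnerProductGeometry.cos_angle, h1, h2, PiLp.inner_apply,
        Fin.sum_univ_three]
      simp [phi]
      linarith
    · intro s
      have h2 : (2 : ENNReal) * ENNReal.ofReal (Real.pi / Real.sqrt κ) =
          ENNReal.ofReal (2 * (Real.pi / Real.sqrt κ)) := by
        rw [ENNReal.ofReal_mul (by norm_num)]; simp
      have := Real.pi_pos
      rw [h2, ENNReal.ofReal_lt_ofReal_iff (by positivity), ← mul_div_assoc, lt_div_iff₀ hr,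
        mul_comm s]
      simp

/-! ### Cyclic conditions -/

/-- The prefix sums of the side lengths of a polygon bound its distances. -/
lemma dist_le_sum_sub {X : Type*} [MetricSpace X] (f : ℕ → X) {i j : ℕ} (hij : i ≤ j) :
    dist (f i) (f j) ≤ ∑ l ∈ Finset.range j, dist (f l) (f (l + 1)) -
      ∑ l ∈ Finset.range i, dist (f l) (f (l + 1)) := by
  rw [← Finset.sum_Ico_eq_sub _ hij]
  exact dist_le_Ico_sum_dist f hij

/-- The perimeter of a polygon with vertices indexed by `ℤ/(N + 1)ℤ`. -/
lemma sum_zmod_eq {X : Type*} [MetricSpace X] (N : ℕ) (f : ZMod (N + 1) → X) :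
    ∑ i : ZMod (N + 1), dist (f i) (f (i + 1)) =
      ∑ i ∈ Finset.range N, dist (f (i : ℕ)) (f ((i + 1 : ℕ) : ZMod (N + 1))) +
        dist (f ((0 : ℕ) : ZMod (N + 1))) (f ((N : ℕ) : ZMod (N + 1))) := by
  have h1 : ∑ i : ZMod (N + 1), dist (f i) (f (i + 1)) =
      ∑ i ∈ Finset.range (N + 1), dist (f (i : ℕ)) (f ((i + 1 : ℕ) : ZMod (N + 1))) := by
    rw [← Fin.sum_univ_eq_sum_range
      (fun i => dist (f (i : ℕ)) (f ((i + 1 : ℕ) : ZMod (N + 1)))) (N + 1)]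
    refine Finset.sum_congr rfl fun (i : ZMod (N + 1)) _ => ?_
    have hi : ((ZMod.val i : ℕ) : ZMod (N + 1)) = i := ZMod.natCast_zmod_val i
    change _ = dist (f (ZMod.val i : ℕ)) (f ((ZMod.val i + 1 : ℕ) : ZMod (N + 1)))
    rw [Nat.cast_add, hi, Nat.cast_one]
  rw [h1, Finset.sum_range_succ]
  congr 1
  rw [dist_comm, ZMod.natCast_self]
  simp

/-- The vertices of a polygon in a `Cycl₄(κ)` space satisfy the comparison for quadrilaterals. -/
lemma isPolyDist_of_isCycl {κ : ℝ} {X : Type*} [MetricSpace X] (hX : IsCycl κ 4 X)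
    {k : SignType} {c : ℝ} (hc : 0 < c) {φ : (modelPlane κ).carrier → Pt k}
    (hφ : ∀ u v, d (φ u) (φ v) = c * (modelPlane κ).d u v)
    (hdiam : ∀ s : ℝ, ENNReal.ofReal s < 2 * modelDiam κ ↔ (k = .pos → c * s < 2 * Real.pi))
    (f : ℕ → X) (N : ℕ)
    (hper : k = .pos →
      c * (∑ i ∈ Finset.range N, dist (f i) (f (i + 1)) + dist (f 0) (f N)) < 2 * Real.pi) :
    IsPolyDist k N (fun i j => c * dist (f i) (f j)) where
  symm i j := by rw [dist_comm]
  tri i j l _ _ _ := by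
    rw [← mul_add]
    exact mul_le_mul_of_nonneg_left (dist_triangle _ _ _) hc.le
  quad i j l r hij hjl hlr hr := by
    have h1 := dist_le_sum_sub f hij.le
    have h2 := dist_le_sum_sub f hjl.le
    have h3 := dist_le_sum_sub f hlr.le
    have h4 := dist_le_sum_sub f hr
    have h5 := dist_le_sum_sub f (Nat.zero_le i)
    have h6 := dist_triangle4 (f r) (f N) (f 0) (f i)
    rw [dist_comm (f N) (f 0)] at h6
    simp only [Finset.range_zero, Finset.sum_empty] at h5
    let q : ZMod 4 → X := ![f i, f j, f l, f r]
    have hsum : ∑ i : ZMod 4, dist (q i) (q (i + 1)) =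
        dist (f i) (f j) + dist (f j) (f l) + dist (f l) (f r) + dist (f r) (f i) := by
      let s : ZMod 4 → ℝ := fun i => dist (q i) (q (i + 1))
      exact Fin.sum_univ_four s
    obtain ⟨p, hp1, hp2⟩ := hX q (by
      rw [hsum, hdiam]
      intro hk
      refine lt_of_le_of_lt (mul_le_mul_of_nonneg_left ?_ hc.le) (hper hk)
      linarith)
    have s0 := hp1 0
    have s1 := hp1 1
    have s2 := hp1 2
    have s3 := hp1 3
    have d0 := hp2 0 2 (by decide) (by decide)
    have d1 := hp2 1 3 (by decide) (by decide)
    refine ⟨φ (p 0), φ (p 1), φ (p 2), φ (p 3), ?_, ?_, ?_, ?_, ?_, ?_⟩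
    · rw [hφ]; exact mul_le_mul_of_nonneg_left s0 hc.le
    · rw [hφ]; exact mul_le_mul_of_nonneg_left s1 hc.le
    · rw [hφ]; exact mul_le_mul_of_nonneg_left s2 hc.le
    · rw [d_comm, hφ, dist_comm]; exact mul_le_mul_of_nonneg_left s3 hc.le
    · rw [hφ]; exact mul_le_mul_of_nonneg_left d0 hc.le
    · rw [hφ]; exact mul_le_mul_of_nonneg_left d1 hc.le
  per hk := by
    rw [← Finset.mul_sum, ← mul_add]
    exact hper hk

end ModelGeometry

open ModelGeometry in
theorem mainTheorem2 (κ : ℝ) {X : Type*} [MetricSpace X] (hX : IsCycl κ 4 X)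
    (n : ℕ) [NeZero n] (hn : 4 ≤ n) : IsCycl κ n X := by
  obtain ⟨k, c, φ, hc, hsurj, hφ, hdiam⟩ := exists_chart κ
  obtain ⟨M, rfl⟩ : ∃ M, n = M + 2 + 1 := ⟨n - 3, by omega⟩
  intro f hf
  rw [hdiam, sum_zmod_eq] at hf
  obtain ⟨g, hg⟩ := exists_realizes M _
    (isPolyDist_of_isCycl hX hc hφ hdiam (fun i => f (i : ZMod (M + 2 + 1))) (M + 2) hf)
  choose ψ hψ using hsurj
  have hval : ∀ i : ZMod (M + 2 + 1), ((i.val : ℕ) : ZMod (M + 2 + 1)) = i :=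
    fun i => ZMod.natCast_zmod_val i
  have hlt : ∀ i : ZMod (M + 2 + 1), i.val < M + 2 + 1 := fun i => ZMod.val_lt i
  have hd : ∀ i j : ZMod (M + 2 + 1), c * (modelPlane κ).d (ψ (g i.val)) (ψ (g j.val)) =
      d (g i.val) (g j.val) := fun i j => by rw [← hφ, hψ, hψ]
  refine ⟨fun i => ψ (g i.val), fun i => ?_, fun i j _ _ => ?_⟩
  · refine le_of_mul_le_mul_left ?_ hc
    rw [hd]
    rcases (Nat.lt_succ_iff.1 (hlt i)).lt_or_eq with h | h
    · have hv : (i + 1).val = i.val + 1 := by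
        rw [ZMod.val_add_of_lt] <;> rw [ZMod.val_one'' (by omega)]
        omega
      rw [hv, hg.side _ h]
      push_cast
      rw [hval]
    · have hi : i + 1 = 0 := by
        rw [← hval i, h]
        exact_mod_cast ZMod.natCast_self (M + 2 + 1)
      have h0 := hg.close
      simp only [Nat.cast_zero] at h0
      have e : ((M + 2 : ℕ) : ZMod (M + 2 + 1)) = i := (congrArg Nat.cast h).symm.trans (hval i)
      rw [e] at h0
      rw [hi, ZMod.val_zero, d_comm, h, h0, dist_comm]
  · refine le_of_mul_le_mul_left ?_ hc
    rw [hd]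
    rcases lt_trichotomy i.val j.val with h | h | h
    · have := hg.diag i.val j.val h (Nat.lt_succ_iff.1 (hlt j))
      simpa only [hval] using this
    · have : i = j := ZMod.val_injective _ h
      subst this
      simp
    · have := hg.diag j.val i.val h (Nat.lt_succ_iff.1 (hlt i))
      rw [dist_comm, d_comm]
      simpa only [hval] using this
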